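/- Conventions. A \emph{square-free ring} is a basic indecomposable (left and right) artinian ring $R$ with identity such that, in every indecomposable direct summand of ${}_RR$ and of $R_R$, each simple module occurs at most once as a composition factor. A \emph{square-free semigroup} is a semigroup $S$ with zero $\theta$ and a finite set $E\subseteq S\setminus\{\theta\}$ of pairwise orthogonal idempotents such that $S=\bigcup_{e,f\in E}eSf$ and $|eSf\setminus\{\theta\}|\le 1$ for all $e,f\in E$; put $S^*=S\setminus\{\theta\}$. Let $D$ be a division ring, $D^*$ its group of units, $\operatorname{Aut}D$ its group of ring automorphisms, and $\rho_d(x)=dxd^{-1}$ for $d\in D^*$. A \emph{2-cocycle} $(\alpha,\xi)\in Z^2(S,D^*)$ consists of automorphisms $\alpha_s\in\operatorname{Aut}D$ $(s\in S^*)$ and units $\xi(s,t)\in D^*$ $(s,t\in S,\ s\cdot t\ne\theta)$ such that $\alpha_s\circ\alpha_t=\rho_{\xi(s,t)}\circ\alpha_{s\cdot t}$ whenever $s\cdot t\neq\theta$, and $\alpha_s(\xi(t,u))\,\xi(s,t\cdot u)=\xi(s,t)\,\xi(s\cdot t,u)$ whenever $s\cdot t\cdot u\ne\theta$. The ring $D^\alpha_\xi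 S$ is the left $D$-vector space with basis $S^*$ and multiplication determined by $(as)(bt)=a\,\alpha_s(b)\,\xi(s,t)\,(s\cdot t)$ if $s\cdot t\neq\theta$ and $(as)(bt)=0$ otherwise $(a,b\in D)$. Consider pairs $(\mu,\eta)$ of functions $\mu:E\to\operatorname{Aut}D$, $\eta:S^*\to D^*$, with the group law $(\mu,\eta)(\mu',\eta')=(\mu\mu',\ s\mapsto\mu_e(\eta'(s))\,\eta(s))$ for $s=e\cdot s$. Write $(\mu,\eta)*(\alpha,\xi)=(\beta,\zeta)$ if $\mu_e\circ\beta_s\circ\mu_f^{-1}=\rho_{\eta(s)}\circ\alpha_s$ for all $s=e\cdot s\cdot f\in S^*$ and $\mu_e(\zeta(s,t))=\eta(s)\,\alpha_s(\eta(t))\,\xi(s,t)\,\eta(s\cdot t)^{-1}$ for all $s=e\cdot s$ and $t$ with $s\cdot t\ne\theta$; let $[\alpha,\xi]$ be the class of $(\alpha,\xi)$ for the resulting equivalence relation on $Z^2(S,D^*)$. For a semigroup automorphism $\phi\in\operatorname{Aut}S$ put $\alpha^\phi_s=\alpha_{\phi(s)}$, $\xi^\phi(s,t)=\xi(\phi(s),\phi(t))$,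 and $$\operatorname{Stab}_{[\alpha,\xi]}(\operatorname{Aut}S)=\{\phi\in\operatorname{Aut}S : [\alpha,\xi]=[\alpha^\phi,\xi^\phi]\}.$$ Let $Z^1_{(\alpha,\xi)}(S,D^*)$ be the group of all $(\mu,\eta)$ with $(\mu,\eta)*(\alpha,\xi)=(\alpha,\xi)$, let $B^1_{(\alpha,\xi)}(S,D^*)$ be its normal subgroup of all pairs $\mu_e=\rho_{\epsilon(e)}$, $\eta(s)=\epsilon(e)\,\alpha_s(\epsilon(f)^{-1})$ $(s=e\cdot s\cdot f)$ with $\epsilon:E\to D^*$, and let $H^1_{(\alpha,\xi)}(S,D^*)=Z^1_{(\alpha,\xi)}(S,D^*)/B^1_{(\alpha,\xi)}(S,D^*)$. \textbf{Corollary.} Let $R$ be a square-free ring with $R\cong D^\alpha_\xi S$ as rings, where $D$ is a division ring, $S$ a square-free semigroup and $(\alpha,\xi)\in Z^2(S,D^*)$. Then every ring automorphism of $R$ is inner (i.e. of the form $x\mapsto rxr^{-1}$ with $r\in R$ a unit) if and only if both $H^1_{(\alpha,\xi)}(S,D^*)$ and $\operatorname{Stab}_{[\alpha,\xi]}(\operatorname{Aut}S)$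 are trivial. -/

import Mathlib

/-! ### Square-free rings -/

/-- A nonzero submodule that is not the internal direct sum of two nonzero submodules. -/
def IsIndecomposableSubmodule {R M : Type*} [Ring R] [AddCommGroup M] [Module R M]
    (N : Submodule R M) : Prop :=
  N ≠ ⊥ ∧ ∀ A B : Submodule R M, A ⊔ B = N → A ⊓ B = ⊥ → A = ⊥ ∨ B = ⊥

/-- The number of composition factors of the composition series `s` that are isomorphic to `T`. -/
noncomputable def compMultiplicity {R M : Type*} [Ring R] [AddCommGroup M] [Module R M]
    (s : CompositionSeries (Submodule R M)) (T : Type*) [AddCommGroup T] [Module R T] : ℕ :=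
  Nat.card {i : Fin s.length //
    Nonempty ((↥(s i.succ) ⧸ (s i.castSucc).submoduleOf (s i.succ)) ≃ₗ[R] T)}

/-- A (finite length) module is square-free if, in each indecomposable direct summand, every simple
module occurs at most once as a composition factor. Every simple module is isomorphic to `R ⧸ m`
for some maximal left ideal `m`. -/
def IsSquareFreeModule (R M : Type*) [Ring R] [AddCommGroup M] [Module R M] : Prop :=
  ∀ N : Submodule R M, (∃ N' : Submodule R M, IsCompl N N') → IsIndecomposableSubmodule N →
    ∀ s : CompositionSeries (Submodule R M), s.head = ⊥ → s.last = N →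
      ∀ m : Ideal R, m.IsMaximal → compMultiplicity s (R ⧸ m) ≤ 1

/-- A primitive idempotent: nonzero, and not the sum of two nonzero orthogonal idempotents. -/
def IsPrimitiveIdempotent {R : Type*} [Ring R] (e : R) : Prop :=
  IsIdempotentElem e ∧ e ≠ 0 ∧ ∀ f g : R, IsIdempotentElem f → IsIdempotentElem g →
    f * g = 0 → g * f = 0 → e = f + g → f = 0 ∨ g = 0

/-- A (semiperfect) ring is basic if `1` is a sum of orthogonal primitive idempotents `e i` such
that the left ideals `R (e i)` are pairwise non-isomorphic. -/
def IsBasicRing (R : Type*) [Ring R] : Prop :=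
  ∃ (n : ℕ) (e : Fin n → R), CompleteOrthogonalIdempotents e ∧
    (∀ i, IsPrimitiveIdempotent (e i)) ∧
    ∀ i j, Nonempty (↥(Ideal.span {e i}) ≃ₗ[R] ↥(Ideal.span {e j})) → i = j

/-- A nonzero ring that is not the direct product of two nonzero rings. -/
def IsIndecomposableRing (R : Type*) [Ring R] : Prop :=
  Nontrivial R ∧ ∀ e : R, IsIdempotentElem e → (∀ x : R, e * x = x * e) → e = 0 ∨ e = 1

/-- Square-free rings: basic indecomposable (two-sided) artinian rings that are square-free as a
left and as a right module over themselves. Right modules over `R` are left modules over the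
opposite ring. -/
structure IsSquareFreeRing (R : Type*) [Ring R] : Prop where
  artinian_left : IsArtinianRing R
  artinian_right : IsArtinianRing Rᵐᵒᵖ
  basic : IsBasicRing R
  indecomposable : IsIndecomposableRing R
  squareFree_left : IsSquareFreeModule R R
  squareFree_right : IsSquareFreeModule Rᵐᵒᵖ Rᵐᵒᵖ

/-! ### Square-free semigroups -/

/-- A square-free semigroup: a semigroup with zero `0` and a finite set `E` of nonzero pairwise
orthogonal idempotents such that `S = ⋃ e S f` and each `e S f` has at most one nonzero element. -/
class SquareFreeSemigroup (S : Type*) extends SemigroupWithZero S where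
  E : Finset S
  ne_zero_of_mem : ∀ e ∈ E, e ≠ 0
  idem : ∀ e ∈ E, e * e = e
  orth : ∀ e ∈ E, ∀ f ∈ E, e ≠ f → e * f = 0
  exists_eq : ∀ s : S, ∃ e ∈ E, ∃ f ∈ E, ∃ t : S, s = e * t * f
  thin : ∀ e ∈ E, ∀ f ∈ E, ∀ s t : S, e * s * f ≠ 0 → e * t * f ≠ 0 → e * s * f = e * t * f

namespace SquareFree

open SquareFreeSemigroup

/-- The set `S* = S \ {0}`, which is also `S^{<1>}`. -/
abbrev Nz (S : Type*) [SquareFreeSemigroup S] : Type _ := {s : S // s ≠ 0}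

/-- The set of idempotents `E`, which is also `S^{<0>}`. -/
abbrev Idem (S : Type*) [SquareFreeSemigroup S] : Type _ := {e : S // e ∈ E (S := S)}

section Semigroup

variable {S : Type*} [SquareFreeSemigroup S]

/-- The inclusion of `E` in `S*`. -/
def Idem.star (e : Idem S) : Nz S := ⟨e.1, ne_zero_of_mem e.1 e.2⟩

/-- The product in `S` of two elements of `S*` whose product is nonzero. -/
def Nz.mul (s t : Nz S) (h : s.1 * t.1 ≠ 0) : Nz S := ⟨s.1 * t.1, h⟩

theorem exists_idem (s : S) : ∃ e f : Idem S, e.1 * s = s ∧ s * f.1 = s := by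
  obtain ⟨e, he, f, hf, t, rfl⟩ := exists_eq s
  exact ⟨⟨e, he⟩, ⟨f, hf⟩, by simp [← mul_assoc, idem e he], by simp [mul_assoc, idem f hf]⟩

/-- For `s = e · s · f` in `S*`, the idempotent `e`. -/
noncomputable def lft (s : Nz S) : Idem S := (exists_idem s.1).choose

/-- For `s = e · s · f` in `S*`, the idempotent `f`. -/
noncomputable def rgt (s : Nz S) : Idem S := (exists_idem s.1).choose_spec.choose

theorem lft_mul (s : Nz S) : (lft s).1 * s.1 = s.1 :=
  (exists_idem s.1).choose_spec.choose_spec.1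

theorem mul_rgt (s : Nz S) : s.1 * (rgt s).1 = s.1 :=
  (exists_idem s.1).choose_spec.choose_spec.2

theorem idem_eq {e f : Idem S} (h : e.1 * f.1 ≠ 0) : e = f := by
  by_contra hne
  exact h (orth e.1 e.2 f.1 f.2 fun h' => hne (Subtype.ext h'))

/-- The left idempotent of an element of `S*` is unique. -/
theorem lft_eq {s : Nz S} {e : Idem S} (h : e.1 * s.1 ≠ 0) : lft s = e := by
  refine (idem_eq fun h' => h ?_).symm
  rw [← lft_mul s, ← mul_assoc, h', zero_mul]

/-- The right idempotent of an element of `S*` is unique. -/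
theorem rgt_eq {s : Nz S} {f : Idem S} (h : s.1 * f.1 ≠ 0) : rgt s = f := by
  refine idem_eq fun h' => h ?_
  rw [← mul_rgt s, mul_assoc, h', mul_zero]

theorem rgt_eq_lft {s t : Nz S} (h : s.1 * t.1 ≠ 0) : rgt s = lft t := by
  refine idem_eq fun h' => h ?_
  rw [← mul_rgt s, ← lft_mul t, mul_assoc, ← mul_assoc (rgt s).1, h', zero_mul, mul_zero]

theorem lft_star_mul (s t : Nz S) (h : s.1 * t.1 ≠ 0) : lft (s.mul t h) = lft s :=
  lft_eq (by change (lft s).1 * (s.1 * t.1) ≠ 0; rwa [← mul_assoc, lft_mul])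

theorem rgt_star_mul (s t : Nz S) (h : s.1 * t.1 ≠ 0) : rgt (s.mul t h) = rgt t :=
  rgt_eq (by change (s.1 * t.1) * (rgt t).1 ≠ 0; rwa [mul_assoc, mul_rgt])

theorem idem_star_mul_self (e : Idem S) : e.star.1 * e.star.1 ≠ 0 := by
  change e.1 * e.1 ≠ 0
  rw [idem e.1 e.2]; exact ne_zero_of_mem e.1 e.2

/-- The members of `E` are exactly the nonzero idempotents of `S`. -/
theorem mem_E_iff {x : S} : x ∈ E (S := S) ↔ x ≠ 0 ∧ x * x = x := by
  refine ⟨fun h => ⟨ne_zero_of_mem x h, idem x h⟩, fun ⟨h0, hx⟩ => ?_⟩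
  have hs : (⟨x, h0⟩ : Nz S).1 * (⟨x, h0⟩ : Nz S).1 ≠ 0 := by rw [hx]; exact h0
  have h1 := lft_mul (⟨x, h0⟩ : Nz S)
  have h2 := mul_rgt (⟨x, h0⟩ : Nz S)
  rw [rgt_eq_lft hs] at h2
  set e := lft (⟨x, h0⟩ : Nz S)
  have he := idem e.1 e.2
  have := thin e.1 e.2 e.1 e.2 x e.1 (by simp only at h1 h2; rwa [h1, h2])
    (by rw [he, he]; exact ne_zero_of_mem e.1 e.2)
  simp only at h1 h2
  rw [h1, h2, he, he] at this
  rw [this]; exact e.2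

/-- The map induced on `S*` by an automorphism of `S`. -/
def Nz.map (φ : S ≃* S) (s : Nz S) : Nz S :=
  ⟨φ s.1, fun h => s.2 (φ.injective (h.trans (map_zero φ).symm))⟩

/-- The map induced on `E` by an automorphism of `S`. -/
def Idem.map (φ : S ≃* S) (e : Idem S) : Idem S :=
  ⟨φ e.1, by
    obtain ⟨h0, h1⟩ := mem_E_iff.1 e.2
    exact mem_E_iff.2 ⟨fun h => h0 (φ.injective (h.trans (map_zero φ).symm)),
      by rw [← map_mul, h1]⟩⟩

theorem map_mul_ne_zero (φ : S ≃* S) {s t : Nz S} (h : s.1 * t.1 ≠ 0) :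
    (s.map φ).1 * (t.map φ).1 ≠ 0 := by
  change φ s.1 * φ t.1 ≠ 0
  rw [← map_mul]
  exact fun h' => h (φ.injective (h'.trans (map_zero φ).symm))

theorem star_map_mul (φ : S ≃* S) (s t : Nz S) (h : s.1 * t.1 ≠ 0) :
    (s.mul t h).map φ = (s.map φ).mul (t.map φ) (map_mul_ne_zero φ h) :=
  Subtype.ext (map_mul φ s.1 t.1)

theorem lft_map (φ : S ≃* S) (s : Nz S) : lft (s.map φ) = (lft s).map φ :=
  lft_eq (by
    change φ (lft s).1 * φ s.1 ≠ 0
    rw [← map_mul, lft_mul]; exact (s.map φ).2)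

theorem rgt_map (φ : S ≃* S) (s : Nz S) : rgt (s.map φ) = (rgt s).map φ :=
  rgt_eq (by
    change φ s.1 * φ (rgt s).1 ≠ 0
    rw [← map_mul, mul_rgt]; exact (s.map φ).2)

end Semigroup

/-! ### Cochains, cocycles and cohomology -/

section Coefficients

variable {D : Type*} [DivisionRing D]

/-- The inner automorphism `ρ_d : x ↦ d x d⁻¹`. -/
def rho : Dˣ →* RingAut D where
  toFun d :=
    { toFun := fun x => d * x * (d⁻¹ : Dˣ)
      invFun := fun x => (d⁻¹ : Dˣ) * x * d
      left_inv := fun x => by simp [mul_assoc]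
      right_inv := fun x => by simp [mul_assoc]
      map_mul' := fun x y => by simp [mul_assoc]
      map_add' := fun x y => by simp [mul_add, add_mul] }
  map_one' := by ext x; simp
  map_mul' a b := by ext x; simp [mul_assoc]

theorem rho_apply (d : Dˣ) (x : D) : rho d x = d * x * (d⁻¹ : Dˣ) := rfl

/-- The action of a ring automorphism of `D` on the group of units `D*`. -/
def app (f : RingAut D) : Dˣ →* Dˣ := Units.map (f : D →* D)

@[simp] theorem coe_app (f : RingAut D) (u : Dˣ) : ((app f u : Dˣ) : D) = f u := rfl

theorem app_one (u : Dˣ) : app (1 : RingAut D) u = u := by ext; rfl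

theorem app_mul (f g : RingAut D) (u : Dˣ) : app (f * g) u = app f (app g u) := by ext; rfl

theorem app_rho (d u : Dˣ) : app (rho d) u = d * u * d⁻¹ := by ext; simp [rho_apply]

theorem mul_rho (f : RingAut D) (d : Dˣ) : f * rho d = rho (app f d) * f := by
  ext x
  change f (d * x * (d⁻¹ : Dˣ)) = _
  rw [map_mul, map_mul]
  change _ = f d * f x * _
  congr 1

end Coefficients

variable (S D : Type*) [SquareFreeSemigroup S] [DivisionRing D]

/-- `Z²(S, D*)`: pairs `α ∈ F¹(S, Aut D)` and `ξ ∈ F²(S, D*)` satisfying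
`α_s(ξ(t,u)) ξ(s, t·u) = ξ(s,t) ξ(s·t, u)` whenever `s·t·u ≠ 0`, and
`α_s ∘ α_t = ρ_{ξ(s,t)} ∘ α_{s·t}` whenever `s·t ≠ 0`. -/
@[ext]
structure TwoCocycle where
  α : Nz S → RingAut D
  ξ : ∀ s t : Nz S, s.1 * t.1 ≠ 0 → Dˣ
  cocycle : ∀ (s t u : Nz S) (hst : s.1 * t.1 ≠ 0) (htu : t.1 * u.1 ≠ 0)
    (h₁ : s.1 * (t.mul u htu).1 ≠ 0) (h₂ : (s.mul t hst).1 * u.1 ≠ 0),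
    app (α s) (ξ t u htu) * ξ s (t.mul u htu) h₁ = ξ s t hst * ξ (s.mul t hst) u h₂
  twist : ∀ (s t : Nz S) (h : s.1 * t.1 ≠ 0), α s * α t = rho (ξ s t h) * α (s.mul t h)

/-- Pairs `(μ, η)` with `μ ∈ F⁰(S, Aut D)` and `η ∈ F¹(S, D*)`. -/
@[ext]
structure OneCochain where
  μ : Idem S → RingAut D
  η : Nz S → Dˣ

variable {S D}

namespace OneCochain

/-- The group `F⁰(S, Aut D) ⋉ F¹(S, D*)`, with
`(μ, η)(μ', η') = (μ ∘ μ', s ↦ μ_e(η'(s)) η(s))` for `s = e · s`. This is composition of the maps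
`d s ↦ μ_e(d) η(s) s`. -/
noncomputable instance : Group (OneCochain S D) where
  mul p q := ⟨fun e => p.μ e * q.μ e, fun s => app (p.μ (lft s)) (q.η s) * p.η s⟩
  one := ⟨fun _ => 1, fun _ => 1⟩
  inv p := ⟨fun e => (p.μ e)⁻¹, fun s => app (p.μ (lft s))⁻¹ (p.η s)⁻¹⟩
  mul_assoc p q r := by
    refine OneCochain.ext ?_ ?_
    · funext e; exact mul_assoc _ _ _
    · funext s
      change app (p.μ (lft s) * q.μ (lft s)) (r.η s) * (app (p.μ (lft s)) (q.η s) * p.η s) =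
        app (p.μ (lft s)) (app (q.μ (lft s)) (r.η s) * q.η s) * p.η s
      rw [app_mul, map_mul, mul_assoc]
  one_mul p := by
    refine OneCochain.ext ?_ ?_
    · funext e; exact one_mul _
    · funext s
      change app 1 (p.η s) * 1 = _
      rw [app_one, mul_one]
  mul_one p := by
    refine OneCochain.ext ?_ ?_
    · funext e; exact mul_one _
    · funext s
      change app (p.μ (lft s)) 1 * p.η s = _
      rw [map_one, one_mul]
  inv_mul_cancel p := by
    refine OneCochain.ext ?_ ?_
    · funext e; exact inv_mul_cancel (p.μ e)
    · funext s
      change app (p.μ (lft s))⁻¹ (p.η s) * app (p.μ (lft s))⁻¹ (p.η s)⁻¹ = 1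
      rw [← map_mul, mul_inv_cancel, map_one]

@[simp] theorem one_μ (e : Idem S) : (1 : OneCochain S D).μ e = 1 := rfl
@[simp] theorem one_η (s : Nz S) : (1 : OneCochain S D).η s = 1 := rfl
@[simp] theorem mul_μ (p q : OneCochain S D) (e : Idem S) : (p * q).μ e = p.μ e * q.μ e := rfl
@[simp] theorem mul_η (p q : OneCochain S D) (s : Nz S) :
    (p * q).η s = app (p.μ (lft s)) (q.η s) * p.η s := rfl
@[simp] theorem inv_μ (p : OneCochain S D) (e : Idem S) : (p⁻¹).μ e = (p.μ e)⁻¹ := rfl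
@[simp] theorem inv_η (p : OneCochain S D) (s : Nz S) :
    (p⁻¹).η s = app (p.μ (lft s))⁻¹ (p.η s)⁻¹ := rfl

end OneCochain

/-- The relation `(μ, η) * (α, ξ) = (β, ζ)`: for `s = e · s · f`,
`μ_e ∘ β_s ∘ μ_f⁻¹ = ρ_{η(s)} ∘ α_s`, and for `s · t ≠ 0`,
`μ_e(ζ(s,t)) = η(s) α_s(η(t)) ξ(s,t) η(s·t)⁻¹`. -/
def Carries (p : OneCochain S D) (c b : TwoCocycle S D) : Prop :=
  (∀ s : Nz S, p.μ (lft s) * b.α s * (p.μ (rgt s))⁻¹ = rho (p.η s) * c.α s) ∧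
  ∀ (s t : Nz S) (h : s.1 * t.1 ≠ 0),
    app (p.μ (lft s)) (b.ξ s t h) =
      p.η s * app (c.α s) (p.η t) * c.ξ s t h * (p.η (s.mul t h))⁻¹

theorem Carries.one (c : TwoCocycle S D) : Carries 1 c c :=
  ⟨fun s => by simp, fun s t h => by simp [app_one]⟩

theorem Carries.mul {p q : OneCochain S D} {c b a : TwoCocycle S D}
    (hp : Carries p c b) (hq : Carries q b a) : Carries (p * q) c a := by
  refine ⟨fun s => ?_, fun s t h => ?_⟩
  · have h1 := hp.1 s
    have h2 := hq.1 s
    simp only [OneCochain.mul_μ, OneCochain.mul_η, map_mul, mul_inv_rev]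
    calc p.μ (lft s) * q.μ (lft s) * a.α s * ((q.μ (rgt s))⁻¹ * (p.μ (rgt s))⁻¹)
        = p.μ (lft s) * (q.μ (lft s) * a.α s * (q.μ (rgt s))⁻¹) * (p.μ (rgt s))⁻¹ := by group
      _ = (p.μ (lft s) * rho (q.η s)) * b.α s * (p.μ (rgt s))⁻¹ := by rw [h2]; group
      _ = rho (app (p.μ (lft s)) (q.η s)) * (p.μ (lft s) * b.α s * (p.μ (rgt s))⁻¹) := by
        rw [mul_rho]; group
      _ = _ := by rw [h1]; group
  · have h1 := hp.2 s t h
    have h2 := hq.2 s t h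
    have h3 : p.μ (lft s) * b.α s = rho (p.η s) * c.α s * p.μ (lft t) := by
      rw [← hp.1 s, rgt_eq_lft h]; group
    simp only [OneCochain.mul_μ, OneCochain.mul_η, app_mul, lft_star_mul]
    rw [h2]
    simp only [map_mul, map_inv, h1, mul_inv_rev]
    rw [← app_mul, h3, app_mul, app_mul, app_rho]
    group

theorem Carries.inv {p : OneCochain S D} {c b : TwoCocycle S D}
    (hp : Carries p c b) : Carries p⁻¹ b c := by
  refine ⟨fun s => ?_, fun s t h => ?_⟩
  · have h1 := hp.1 s
    have h2 : c.α s = rho (p.η s)⁻¹ * (p.μ (lft s) * b.α s * (p.μ (rgt s))⁻¹) := by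
      rw [h1, map_inv]; group
    simp only [OneCochain.inv_μ, OneCochain.inv_η]
    rw [h2, ← mul_assoc, mul_rho]
    group
  · have h1 := hp.2 s t h
    have h3 : p.μ (lft s) * b.α s = rho (p.η s) * c.α s * p.μ (lft t) := by
      rw [← hp.1 s, rgt_eq_lft h]; group
    have h4 : b.α s = (p.μ (lft s))⁻¹ * rho (p.η s) * c.α s * p.μ (lft t) := by
      rw [mul_assoc _ _ (p.μ (lft t)), mul_assoc, ← mul_assoc (rho _), ← h3]; group
    have h5 : b.ξ s t h = app (p.μ (lft s))⁻¹
        (p.η s * app (c.α s) (p.η t) * c.ξ s t h * (p.η (s.mul t h))⁻¹) := by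
      rw [← h1, ← app_mul, inv_mul_cancel, app_one]
    simp only [OneCochain.inv_μ, OneCochain.inv_η, lft_star_mul]
    rw [h5, h4, ← app_mul]
    rw [mul_assoc _ (p.μ (lft t)), mul_inv_cancel, mul_one, app_mul, app_mul, app_rho]
    simp only [map_mul, map_inv]
    group

/-- Two cocycles are cohomologous if they lie in the same orbit under
`F⁰(S, Aut D) ⋉ F¹(S, D*)`. -/
def Cohomologous (c b : TwoCocycle S D) : Prop := ∃ p : OneCochain S D, Carries p c b

theorem cohomologous_equivalence : Equivalence (Cohomologous (S := S) (D := D)) :=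
  ⟨fun c => ⟨1, Carries.one c⟩, fun ⟨p, hp⟩ => ⟨p⁻¹, hp.inv⟩,
    fun ⟨p, hp⟩ ⟨q, hq⟩ => ⟨p * q, hp.mul hq⟩⟩

/-- The setoid of cohomologous cocycles. -/
def cohSetoid (S D : Type*) [SquareFreeSemigroup S] [DivisionRing D] :
    Setoid (TwoCocycle S D) := ⟨Cohomologous, cohomologous_equivalence⟩

/-- The thin 2-cohomology `H²(S, D*)`. -/
def ThinH2 (S D : Type*) [SquareFreeSemigroup S] [DivisionRing D] : Type _ :=
  Quotient (cohSetoid S D)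

/-- The class `[α, ξ]` in the thin 2-cohomology. -/
def TwoCocycle.cls (c : TwoCocycle S D) : ThinH2 S D := Quotient.mk (cohSetoid S D) c

theorem cls_eq_iff {c b : TwoCocycle S D} : c.cls = b.cls ↔ Cohomologous c b :=
  ⟨fun h => Quotient.exact h, fun h => Quotient.sound (s := cohSetoid S D) h⟩

/-- The cocycle `(α^φ, ξ^φ)` with `α^φ_s = α_{φ(s)}` and `ξ^φ(s,t) = ξ(φ(s), φ(t))`. -/
def TwoCocycle.precomp (c : TwoCocycle S D) (φ : S ≃* S) : TwoCocycle S D where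
  α s := c.α (s.map φ)
  ξ s t h := c.ξ (s.map φ) (t.map φ) (map_mul_ne_zero φ h)
  cocycle s t u hst htu h₁ h₂ := by
    have a₁ := map_mul_ne_zero φ h₁
    have a₂ := map_mul_ne_zero φ h₂
    have e₁ := star_map_mul φ t u htu
    have e₂ := star_map_mul φ s t hst
    have key : ∀ (x y : Nz S) (b₁ : (s.map φ).1 * x.1 ≠ 0) (b₂ : y.1 * (u.map φ).1 ≠ 0),
        x = (t.map φ).mul (u.map φ) (map_mul_ne_zero φ htu) →
        y = (s.map φ).mul (t.map φ) (map_mul_ne_zero φ hst) →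
        app (c.α (s.map φ)) (c.ξ (t.map φ) (u.map φ) (map_mul_ne_zero φ htu)) *
            c.ξ (s.map φ) x b₁ =
          c.ξ (s.map φ) (t.map φ) (map_mul_ne_zero φ hst) * c.ξ y (u.map φ) b₂ := by
      rintro x y b₁ b₂ rfl rfl
      exact c.cocycle (s.map φ) (t.map φ) (u.map φ) _ _ _ _
    exact key _ _ a₁ a₂ e₁ e₂
  twist s t h := by
    rw [star_map_mul]
    exact c.twist (s.map φ) (t.map φ) _

theorem Carries.precomp {p : OneCochain S D} {c b : TwoCocycle S D} (hp : Carries p c b)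
    (φ : S ≃* S) :
    Carries ⟨fun e => p.μ (e.map φ), fun s => p.η (s.map φ)⟩ (c.precomp φ) (b.precomp φ) := by
  refine ⟨fun s => ?_, fun s t h => ?_⟩
  · have := hp.1 (s.map φ)
    rw [lft_map, rgt_map] at this
    exact this
  · have := hp.2 (s.map φ) (t.map φ) (map_mul_ne_zero φ h)
    rw [lft_map, ← star_map_mul] at this
    exact this

theorem Cohomologous.precomp {c b : TwoCocycle S D} (h : Cohomologous c b) (φ : S ≃* S) :
    Cohomologous (c.precomp φ) (b.precomp φ) :=
  let ⟨_, hp⟩ := h; ⟨_, hp.precomp φ⟩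

/-- The stabilizer `{φ ∈ Aut S | [α, ξ] = [α^φ, ξ^φ]}` as a subgroup of `Aut S`. -/
def stab (c : TwoCocycle S D) : Subgroup (MulAut S) where
  carrier := {φ | c.cls = (c.precomp φ).cls}
  one_mem' := rfl
  mul_mem' {φ ψ} hφ hψ := by
    have h1 := (cls_eq_iff.1 hφ).precomp ψ
    exact cls_eq_iff.2 (cohomologous_equivalence.trans (cls_eq_iff.1 hψ) h1)
  inv_mem' {φ} hφ := by
    have h1 := (cls_eq_iff.1 hφ).precomp φ⁻¹
    have h2 : (c.precomp φ).precomp φ⁻¹ = c := by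
      have key : ∀ s : Nz S, (s.map φ⁻¹).map φ = s := fun s =>
        Subtype.ext (MulEquiv.apply_symm_apply φ s.1)
      refine TwoCocycle.ext ?_ ?_
      · funext s; exact congrArg c.α (key s)
      · funext s t h
        change c.ξ ((s.map φ⁻¹).map φ) ((t.map φ⁻¹).map φ) _ = _
        congr 1 <;> exact key _
    rw [h2] at h1
    exact cls_eq_iff.2 (cohomologous_equivalence.symm h1)

/-- The group `Z¹_{(α,ξ)}(S, D*)` of `(α, ξ)` 1-cocycles: the pairs `(μ, η)` with
`μ_e ∘ α_s ∘ μ_f⁻¹ = ρ_{η(s)} ∘ α_s` and `μ_e(ξ(s,t)) = η(s) α_s(η(t)) ξ(s,t) η(s·t)⁻¹`. -/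
noncomputable def Z1 (c : TwoCocycle S D) : Subgroup (OneCochain S D) where
  carrier := {p | Carries p c c}
  one_mem' := Carries.one c
  mul_mem' hp hq := Carries.mul hp hq
  inv_mem' hp := Carries.inv hp

/-- The pair `ε ⋆ (μ, η)`: for `s = e · s · f`,
`μ_e` is replaced by `ρ_{ε(e)} ∘ μ_e` and `η(s)` by `ε(e) η(s) α_s(ε(f)⁻¹)`. -/
noncomputable def starAct (c : TwoCocycle S D) (ε : Idem S → Dˣ) (p : OneCochain S D) :
    OneCochain S D :=
  ⟨fun e => rho (ε e) * p.μ e, fun s => ε (lft s) * p.η s * app (c.α s) (ε (rgt s))⁻¹⟩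

theorem starAct_mul (c : TwoCocycle S D) (ε δ : Idem S → Dˣ) (p : OneCochain S D) :
    starAct c (fun e => ε e * δ e) p = starAct c ε (starAct c δ p) := by
  refine OneCochain.ext ?_ ?_
  · funext e; simp only [starAct, map_mul, mul_assoc]
  · funext s; simp only [starAct, map_mul, mul_assoc, mul_inv_rev]

theorem starAct_one (c : TwoCocycle S D) (p : OneCochain S D) :
    starAct c (fun _ => 1) p = p := by
  refine OneCochain.ext ?_ ?_
  · funext e; simp [starAct]
  · funext s; simp [starAct]

theorem starAct_mem (c : TwoCocycle S D) (ε : Idem S → Dˣ) {p : OneCochain S D} (hp : p ∈ Z1 c) :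
    starAct c ε p ∈ Z1 c := by
  refine ⟨fun s => ?_, fun s t h => ?_⟩
  · have h1 : p.μ (lft s) * c.α s = rho (p.η s) * c.α s * p.μ (rgt s) := by
      rw [← hp.1 s]; group
    simp only [starAct, map_mul, mul_inv_rev]
    rw [mul_assoc (rho (ε (lft s))), h1]
    have h2 : c.α s * (rho (ε (rgt s)))⁻¹ = rho (app (c.α s) (ε (rgt s))⁻¹) * c.α s := by
      rw [← map_inv, mul_rho]
    have h3 : (rho (ε (lft s)) * (rho (p.η s) * c.α s * p.μ (rgt s))) *
        ((p.μ (rgt s))⁻¹ * (rho (ε (rgt s)))⁻¹) =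
        rho (ε (lft s)) * rho (p.η s) * (c.α s * (rho (ε (rgt s)))⁻¹) := by group
    rw [h3, h2, mul_assoc, mul_assoc, mul_assoc]
  · have h1 := hp.2 s t h
    have h2 : ∀ u, app (c.α s) (app (c.α t) u) =
        c.ξ s t h * app (c.α (s.mul t h)) u * (c.ξ s t h)⁻¹ := fun u => by
      rw [← app_mul, c.twist s t h, app_mul, app_rho]
    simp only [starAct, app_mul, app_rho, h1, map_mul, map_inv, lft_star_mul, rgt_star_mul,
      mul_inv_rev, rgt_eq_lft h, h2]
    group

/-- The group `B¹_{(α,ξ)}(S, D*)` of `(α, ξ)` 1-coboundaries: the orbit of `(1, 1)` under `⋆`. -/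
noncomputable def B1 (c : TwoCocycle S D) : Subgroup (Z1 c) where
  carrier := {z | ∃ ε : Idem S → Dˣ, starAct c ε 1 = z.1}
  one_mem' := ⟨fun _ => 1, starAct_one c 1⟩
  mul_mem' := by
    rintro ⟨_, _⟩ ⟨_, _⟩ ⟨ε, rfl⟩ ⟨δ, rfl⟩
    refine ⟨fun e => ε e * δ e, OneCochain.ext ?_ ?_⟩
    · funext e; simp [starAct]
    · funext s
      simp only [starAct, Subgroup.coe_mul, OneCochain.mul_η, app_rho, map_mul, map_inv,
        OneCochain.one_η, OneCochain.one_μ, mul_inv_rev, mul_one]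
      group
  inv_mem' := by
    rintro ⟨_, _⟩ ⟨ε, rfl⟩
    refine ⟨fun e => (ε e)⁻¹, OneCochain.ext ?_ ?_⟩
    · funext e; simp [starAct]
    · funext s
      simp only [starAct, Subgroup.coe_inv, OneCochain.inv_η, mul_inv_rev,
        OneCochain.one_η, OneCochain.one_μ, mul_one, inv_inv]
      rw [← map_inv rho, app_rho]
      simp only [map_inv, inv_inv]
      group

instance (c : TwoCocycle S D) : (B1 c).Normal where
  conj_mem := by
    rintro ⟨_, _⟩ ⟨ε, rfl⟩ ⟨p, hp⟩
    refine ⟨fun e => app (p.μ e) (ε e), OneCochain.ext ?_ ?_⟩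
    · funext e
      simp only [starAct, Subgroup.coe_mul, Subgroup.coe_inv, OneCochain.mul_μ, OneCochain.inv_μ,
        OneCochain.one_μ, mul_one]
      rw [mul_rho]; group
    · funext s
      have h1 : p.μ (lft s) * c.α s = rho (p.η s) * c.α s * p.μ (rgt s) := by
        rw [← hp.1 s]; group
      have h2 : ∀ u, app (p.μ (lft s)) (app (c.α s) u) =
          p.η s * app (c.α s) (app (p.μ (rgt s)) u) * (p.η s)⁻¹ := fun u => by
        rw [← app_mul, h1, app_mul, app_mul, app_rho]
      have h3 : ∀ u, app (p.μ (lft s)) (app (p.μ (lft s))⁻¹ u) = u := fun u => by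
        rw [← app_mul, mul_inv_cancel, app_one]
      simp only [starAct, Subgroup.coe_mul, Subgroup.coe_inv, OneCochain.mul_η, OneCochain.inv_η,
        OneCochain.mul_μ, OneCochain.one_μ, OneCochain.one_η, mul_one, app_mul, app_rho, map_mul,
        map_inv, h2, h3]
      group

/-- The first cohomology group `H¹_{(α,ξ)}(S, D*) = Z¹ / B¹`. -/
abbrev H1 (c : TwoCocycle S D) : Type _ := Z1 c ⧸ B1 c

/-! ### The twisted semigroup ring -/

/-- The underlying left `D`-vector space on `S*` of the twisted semigroup ring `D^α_ξ S`. -/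
def TwistedRing (_c : TwoCocycle S D) : Type _ := Nz S →₀ D

namespace TwistedRing

variable (c : TwoCocycle S D)

noncomputable instance : AddCommGroup (TwistedRing c) :=
  inferInstanceAs (AddCommGroup (Nz S →₀ D))

noncomputable instance : Module D (TwistedRing c) :=
  inferInstanceAs (Module D (Nz S →₀ D))

/-- The element `d s`. -/
noncomputable def single (s : Nz S) : D →+ TwistedRing c := Finsupp.singleAddHom s

/-- The additive map on `D^α_ξ S` with prescribed values on the elements `d s`. -/
noncomputable def lift {A : Type*} [AddCommMonoid A] (F : Nz S → D →+ A) : TwistedRing c →+ A :=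
  (Finsupp.liftAddHom F : (Nz S →₀ D) →+ A)

theorem lift_single {A : Type*} [AddCommMonoid A] (F : Nz S → D →+ A) (s : Nz S) (a : D) :
    lift c F (single c s a) = F s a := Finsupp.liftAddHom_apply_single F s a

open Classical in
/-- The product `(a s)(b t)`, equal to `a α_s(b) ξ(s,t) (s·t)` if `s·t ≠ 0` and to `0` otherwise. -/
noncomputable def mulBasis (s t : Nz S) : D →+ D →+ TwistedRing c :=
  if h : s.1 * t.1 ≠ 0 then
    AddMonoidHom.mk' (fun a => AddMonoidHom.mk'
      (fun b => single c (s.mul t h) (a * c.α s b * c.ξ s t h))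
      (fun b b' => by simp [mul_add, add_mul]))
      (fun a a' => by ext b : 1; simp [add_mul])
  else 0

/-- The multiplication of `D^α_ξ S`: the biadditive extension of `mulBasis`. -/
noncomputable def mulHom : TwistedRing c →+ TwistedRing c →+ TwistedRing c :=
  lift c fun s => (lift c fun t => (mulBasis c s t).flip).flip

variable {c}

@[elab_as_elim]
theorem induction {P : TwistedRing c → Prop} (x : TwistedRing c) (h0 : P 0)
    (hadd : ∀ x y, P x → P y → P (x + y)) (hs : ∀ s a, P (single c s a)) : P x :=
  Finsupp.induction_linear x h0 hadd hs

theorem mulHom_single (s t : Nz S) (a b : D) :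
    mulHom c (single c s a) (single c t b) = mulBasis c s t a b := by
  rw [mulHom, lift_single, AddMonoidHom.flip_apply, lift_single, AddMonoidHom.flip_apply]

theorem mulHom_single_of_ne {s t : Nz S} (h : s.1 * t.1 ≠ 0) (a b : D) :
    mulHom c (single c s a) (single c t b) =
      single c (s.mul t h) (a * c.α s b * c.ξ s t h) := by
  rw [mulHom_single, mulBasis, dif_pos h]; rfl

theorem mulHom_single_of_eq {s t : Nz S} (h : s.1 * t.1 = 0) (a b : D) :
    mulHom c (single c s a) (single c t b) = 0 := by
  rw [mulHom_single, mulBasis, dif_neg (not_not.2 h)]; rfl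

theorem mulHom_assoc (x y z : TwistedRing c) :
    mulHom c (mulHom c x y) z = mulHom c x (mulHom c y z) := by
  induction x using induction with
  | h0 => simp
  | hadd x x' hx hx' => simp only [map_add, AddMonoidHom.add_apply, hx, hx']
  | hs s a =>
    induction y using induction with
    | h0 => simp
    | hadd x x' hx hx' => simp only [map_add, AddMonoidHom.add_apply, hx, hx']
    | hs t b =>
      induction z using induction with
      | h0 => simp
      | hadd x x' hx hx' => simp only [map_add, hx, hx']
      | hs u d =>
        by_cases hst : s.1 * t.1 = 0
        · rw [mulHom_single_of_eq hst, map_zero, AddMonoidHom.zero_apply]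
          by_cases htu : t.1 * u.1 = 0
          · rw [mulHom_single_of_eq htu, map_zero]
          · rw [mulHom_single_of_ne htu, mulHom_single_of_eq]
            change s.1 * (t.1 * u.1) = 0
            rw [← mul_assoc, hst, zero_mul]
        · rw [mulHom_single_of_ne hst]
          by_cases htu : t.1 * u.1 = 0
          · rw [mulHom_single_of_eq htu, map_zero, mulHom_single_of_eq]
            change (s.1 * t.1) * u.1 = 0
            rw [mul_assoc, htu, mul_zero]
          · rw [mulHom_single_of_ne htu]
            by_cases h : s.1 * t.1 * u.1 = 0
            · rw [mulHom_single_of_eq, mulHom_single_of_eq]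
              · change s.1 * (t.1 * u.1) = 0
                rw [← mul_assoc, h]
              · exact h
            · have h₁ : s.1 * (t.mul u htu).1 ≠ 0 := by
                change s.1 * (t.1 * u.1) ≠ 0
                rwa [← mul_assoc]
              have h₂ : (s.mul t hst).1 * u.1 ≠ 0 := h
              rw [mulHom_single_of_ne h₁, mulHom_single_of_ne h₂]
              have e : (s.mul t hst).mul u h₂ = s.mul (t.mul u htu) h₁ :=
                Subtype.ext (mul_assoc s.1 t.1 u.1)
              rw [e]
              congr 1
              have k1 : (c.ξ s t hst : D) * c.α (s.mul t hst) d =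
                  c.α s (c.α t d) * c.ξ s t hst := by
                have := congrArg (fun f : RingAut D => f d) (c.twist s t hst)
                simp only [RingAut.mul_apply, rho_apply] at this
                rw [this]; simp [mul_assoc]
              have k2 := congrArg (fun v : Dˣ => (v : D)) (c.cocycle s t u hst htu h₁ h₂)
              simp only [Units.val_mul, coe_app] at k2
              rw [map_mul, map_mul]
              calc a * c.α s b * c.ξ s t hst * c.α (s.mul t hst) d * c.ξ (s.mul t hst) u h₂
                  = a * c.α s b * (c.ξ s t hst * c.α (s.mul t hst) d) *
                      c.ξ (s.mul t hst) u h₂ := by simp only [mul_assoc]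
                _ = a * c.α s b * c.α s (c.α t d) *
                      (c.ξ s t hst * c.ξ (s.mul t hst) u h₂) := by
                    rw [k1]; simp only [mul_assoc]
                _ = _ := by rw [← k2]; simp only [mul_assoc]

variable (c) in
/-- The identity element `∑ e, ξ(e,e)⁻¹ e` of `D^α_ξ S`; it is `∑ e, e` if the cocycle is
normal. -/
noncomputable def oneElem : TwistedRing c :=
  ∑ e : Idem S, single c e.star ((c.ξ e.star e.star (idem_star_mul_self e))⁻¹ : Dˣ)

theorem alpha_idem (e : Idem S) :
    c.α e.star = rho (c.ξ e.star e.star (idem_star_mul_self e)) := by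
  have h := c.twist e.star e.star (idem_star_mul_self e)
  have e1 : e.star.mul e.star (idem_star_mul_self e) = e.star := Subtype.ext (idem e.1 e.2)
  rw [e1] at h
  exact mul_right_cancel h

theorem xi_congr {s t s' t' : Nz S} (hs : s = s') (ht : t = t') (h : s.1 * t.1 ≠ 0)
    (h' : s'.1 * t'.1 ≠ 0) : c.ξ s t h = c.ξ s' t' h' := by subst hs ht; rfl

theorem xi_left (s : Nz S) (h : (lft s).star.1 * s.1 ≠ 0) :
    c.ξ (lft s).star s h = c.ξ (lft s).star (lft s).star (idem_star_mul_self _) := by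
  have e1 : (lft s).star.mul s h = s := Subtype.ext (lft_mul s)
  have e2 : (lft s).star.mul (lft s).star (idem_star_mul_self _) = (lft s).star :=
    Subtype.ext (idem _ (lft s).2)
  have k := c.cocycle (lft s).star (lft s).star s (idem_star_mul_self _) h
    (by rw [e1]; exact h) (by rw [e2]; exact h)
  rw [xi_congr rfl e1 _ h, xi_congr e2 rfl _ h] at k
  have k' := mul_right_cancel k
  rw [alpha_idem, app_rho] at k'
  exact mul_left_cancel (mul_right_cancel (k'.trans (by group)) :
    c.ξ (lft s).star (lft s).star (idem_star_mul_self _) * c.ξ (lft s).star s h =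
      c.ξ (lft s).star (lft s).star (idem_star_mul_self _) *
        c.ξ (lft s).star (lft s).star (idem_star_mul_self _))

theorem xi_right (s : Nz S) (h : s.1 * (rgt s).star.1 ≠ 0) :
    app (c.α s) (c.ξ (rgt s).star (rgt s).star (idem_star_mul_self _)) =
      c.ξ s (rgt s).star h := by
  have e1 : s.mul (rgt s).star h = s := Subtype.ext (mul_rgt s)
  have e2 : (rgt s).star.mul (rgt s).star (idem_star_mul_self _) = (rgt s).star :=
    Subtype.ext (idem _ (rgt s).2)
  have k := c.cocycle s (rgt s).star (rgt s).star h (idem_star_mul_self _)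
    (by rw [e2]; exact h) (by rw [e1]; exact h)
  rw [xi_congr rfl e2 _ h, xi_congr e1 rfl _ h] at k
  exact mul_right_cancel k

theorem one_mulHom (x : TwistedRing c) : mulHom c (oneElem c) x = x := by
  induction x using induction with
  | h0 => simp
  | hadd x y hx hy => rw [map_add, hx, hy]
  | hs s a =>
    rw [oneElem, map_sum, AddMonoidHom.finsetSum_apply, Finset.sum_eq_single (lft s)]
    · have h : (lft s).star.1 * s.1 ≠ 0 := by
        change (lft s).1 * s.1 ≠ 0
        rw [lft_mul]; exact s.2
      have e1 : (lft s).star.mul s h = s := Subtype.ext (lft_mul s)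
      rw [mulHom_single_of_ne h, e1, xi_left, alpha_idem, rho_apply]
      congr 1
      simp [mul_assoc]
    · intro e _ hne
      apply mulHom_single_of_eq
      by_contra h
      exact hne (lft_eq (e := e) h).symm
    · intro h; exact absurd (Finset.mem_univ _) h

theorem mulHom_one (x : TwistedRing c) : mulHom c x (oneElem c) = x := by
  induction x using induction with
  | h0 => simp
  | hadd x y hx hy => rw [map_add, AddMonoidHom.add_apply, hx, hy]
  | hs s a =>
    rw [oneElem, map_sum, Finset.sum_eq_single (rgt s)]
    · have h : s.1 * (rgt s).star.1 ≠ 0 := by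
        change s.1 * (rgt s).1 ≠ 0
        rw [mul_rgt]; exact s.2
      have e1 : s.mul (rgt s).star h = s := Subtype.ext (mul_rgt s)
      rw [mulHom_single_of_ne h, e1, ← xi_right, ← coe_app, map_inv]
      congr 1
      simp
    · intro e _ hne
      apply mulHom_single_of_eq
      by_contra h
      exact hne (rgt_eq (f := e) h).symm
    · intro h; exact absurd (Finset.mem_univ _) h

/-- The ring `D^α_ξ S`: `st = ξ(s,t) s·t` if `s·t ≠ 0` and `st = 0` otherwise, and
`s d = α_s(d) s`. -/
noncomputable instance : Ring (TwistedRing c) where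
  __ := (inferInstance : AddCommGroup (TwistedRing c))
  mul x y := mulHom c x y
  one := oneElem c
  mul_assoc := mulHom_assoc
  one_mul := one_mulHom
  mul_one := mulHom_one
  left_distrib x y z := map_add (mulHom c x) y z
  right_distrib x y z := by
    change mulHom c (x + y) z = mulHom c x z + mulHom c y z
    rw [map_add]; rfl
  zero_mul x := by
    change mulHom c 0 x = 0
    rw [map_zero]; rfl
  mul_zero x := map_zero (mulHom c x)

/-- `(a s)(b t) = a α_s(b) ξ(s,t) (s·t)` if `s·t ≠ 0`. -/
theorem single_mul_single {s t : Nz S} (h : s.1 * t.1 ≠ 0) (a b : D) :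
    single c s a * single c t b = single c (s.mul t h) (a * c.α s b * c.ξ s t h) :=
  mulHom_single_of_ne h a b

/-- `(a s)(b t) = 0` if `s·t = 0`. -/
theorem single_mul_single_of_eq {s t : Nz S} (h : s.1 * t.1 = 0) (a b : D) :
    single c s a * single c t b = 0 :=
  mulHom_single_of_eq h a b

end TwistedRing

end SquareFree

/-! The ring `D^α_ξ S` is graded by pairs of idempotents of `S`, and thinness makes each corner `(e,
f)` zero or a single line `D s`. An automorphism that permutes the corner identities therefore has
to be monomial: `a s ↦ μ_e(a) η(s) φ(s)` with `φ ∈ Aut S`. Multiplicativity of such a map says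
exactly that `(μ, η)` carries `(α^φ, ξ^φ)` to `(α, ξ)`. Hence the permutations `φ` that occur form
the stabilizer of the class, and for `φ = 1` the pairs `(μ, η)` form `Z¹`. Conjugation by a diagonal
unit `∑ ε(e)` realizes the elements of `B¹`.

Two facts remain. First, every automorphism is monomial up to an inner one (`exists_conj_monomial`).
Its values on the corner identities, read modulo the nilpotent elements, permute the idempotents of
`S`, and a unit congruent to 1 aligns the two families of idempotents. Second, an inner monomial
automorphism has `φ = 1` and comes from a coboundary (`eq_starAct_of_inner`): comparing coefficients
in `γ(x) r = r x` shows that just the diagonal part of `r` matters. Together they give `inner_iff`.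

Both facts need the projections onto the diagonal corners to be ring homomorphisms to `D`, so no
idempotent of `S` may be a product of non-idempotents (`NoLoops`). This is where basicness enters. A
factorization of `e` through a different idempotent would, by `IsBasicRing.eq_zero_of_factor`,
contradict the pairwise non-isomorphism of the indecomposable projectives. Finally the criterion is
transported along `R ≅ D^α_ξ S`. -/

/-! ### Idempotents in basic rings -/

/-- An idempotent below a primitive idempotent is zero or equal to it. -/
theorem IsPrimitiveIdempotent.eq_of_le {R : Type*} [Ring R] {g h : R}
    (hg : IsPrimitiveIdempotent g) (hh : h * h = h) (h1 : g * h = h) (h2 : h * g = h)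
    (h0 : h ≠ 0) : h = g := by
  have hgg : g * g = g := hg.1
  rcases hg.2.2 h (g - h) hh (by
    change (g - h) * (g - h) = g - h
    simp only [mul_sub, sub_mul, hgg, h1, h2, hh]; abel) (by rw [mul_sub, h2, hh, sub_self])
    (by rw [sub_mul, h1, hh, sub_self]) (by abel) with h | h
  · exact absurd h h0
  · exact (sub_eq_zero.1 h).symm

/-- Idempotents `e = ab` and `f = ba` generate isomorphic left ideals. -/
theorem nonempty_span_equiv {R : Type*} [Ring R] {e f a b : R} (hab : a * b = e) (hba : b * a = f)
    (he : e * e = e) (hf : f * f = f) (hea : e * a = a) (hfb : f * b = b) :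
    Nonempty (↥(Ideal.span {e}) ≃ₗ[R] ↥(Ideal.span {f})) := by
  have haf : a * f = a := by rw [← hba, ← mul_assoc, hab, hea]
  have hbe : b * e = b := by rw [← hab, ← mul_assoc, hba, hfb]
  have key : ∀ {g x : R}, g * g = g → x ∈ Ideal.span {g} → x * g = x := by
    intro g x hg hx
    obtain ⟨r, rfl⟩ := Ideal.mem_span_singleton'.1 hx
    rw [mul_assoc, hg]
  -- Right multiplications by `a` and by `b` are mutually inverse.
  refine ⟨LinearEquiv.ofLinearMap
    (LinearMap.codRestrict _ ((LinearMap.toSpanSingleton R R a).domRestrict _) fun x => ?_)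
    (LinearMap.codRestrict _ ((LinearMap.toSpanSingleton R R b).domRestrict _) fun x => ?_) ?_ ?_⟩
  · exact Ideal.mem_span_singleton'.2 ⟨x.1 * a, by simp [mul_assoc, haf]⟩
  · exact Ideal.mem_span_singleton'.2 ⟨x.1 * b, by simp [mul_assoc, hbe]⟩
  · ext x
    simpa [mul_assoc, hba] using key hf x.2
  · ext x
    simpa [mul_assoc, hab] using key he x.2

/-- In a basic ring, an idempotent `e` with `eRe` a division ring does not factor through an
idempotent orthogonal to it. -/
theorem IsBasicRing.eq_zero_of_factor {R : Type*} [Ring R] (hR : IsBasicRing R) {e f u v : R}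
    (he : e * e = e) (hf : f * f = f) (hef : e * f = 0) (huv : u * f * v = e)
    (hdiv : ∀ x, e * x * e ≠ 0 → ∃ w, (e * x * e) * (e * w * e) = e) : e = 0 := by
  by_contra he0
  obtain ⟨n, g, hg, hprim, hinj⟩ := hR
  have hgg : ∀ i, g i * g i = g i := fun i => (hprim i).1
  have hsum : ∀ a b : R, a * b = ∑ i, a * g i * b := fun a b => by
    rw [← Finset.sum_mul, ← Finset.mul_sum, hg.complete, mul_one]
  obtain ⟨i, hi⟩ : ∃ i, e * g i * e ≠ 0 := by
    by_contra! h
    -- Insert `1 = ∑ g i` between the two factors of `e = e * e`.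
    apply he0
    rw [← he, hsum e e]
    exact Finset.sum_eq_zero fun i _ => h i
  obtain ⟨w, hw⟩ := hdiv _ hi
  -- Invertibility of `e g_i e` in `eRe` makes `e` and `g i` equivalent: `x * y = e`, and `y * x` is
  -- a nonzero idempotent below the primitive `g i`, hence equal to it.
  obtain ⟨x, y, hx, hgx, hy, hgy, hxy⟩ : ∃ x y : R, e * x = x ∧ x * g i = x ∧ y * e = y ∧
      g i * y = y ∧ x * y = e := by
    refine ⟨e * g i, g i * e * w * e, ?_, ?_, ?_, ?_, ?_⟩
    · rw [← mul_assoc, he]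
    · rw [mul_assoc, hgg]
    · rw [mul_assoc, he]
    · simp only [← mul_assoc, hgg]
    · calc e * g i * (g i * e * w * e) = e * (g i * g i) * e * w * e := by simp only [mul_assoc]
        _ = e * g i * (e * e) * w * e := by rw [hgg, he]
        _ = (e * g i * e) * (e * w * e) := by simp only [mul_assoc]
        _ = e := hw
  have hyx : y * x = g i := by
    refine (hprim i).eq_of_le ?_ (by rw [← mul_assoc, hgy]) (by rw [mul_assoc, hgx]) fun h => ?_
    · rw [mul_assoc, ← mul_assoc x, hxy, hx]
    · apply he0
      calc e = x * y * (x * y) := by rw [hxy, he]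
        _ = x * (y * x) * y := by simp only [mul_assoc]
        _ = 0 := by rw [h]; simp
  -- The equivalence moves the division ring property from `eRe` to `g_i R g_i`.
  have hinv : ∀ z, g i * z * g i ≠ 0 → ∃ w, g i * z * g i * w = g i := by
    intro z hz
    have h1 : e * (x * z * y) * e = x * z * y := by
      rw [mul_assoc, mul_assoc _ y, hy, mul_assoc x, ← mul_assoc e, hx]
    obtain ⟨w', hw'⟩ := hdiv (x * z * y) fun h => hz (by
      rw [h1] at h
      calc g i * z * g i = y * (x * z * y) * x := by rw [← hyx]; simp only [mul_assoc]
        _ = 0 := by rw [h]; simp)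
    rw [h1] at hw'
    refine ⟨y * (e * w' * e) * x, ?_⟩
    calc g i * z * g i * (y * (e * w' * e) * x)
        = g i * z * (g i * y) * (e * w' * e) * x := by simp only [mul_assoc]
      _ = y * (x * z * y * (e * w' * e)) * x := by rw [hgy, ← hyx]; simp only [mul_assoc]
      _ = g i := by rw [hw', hy, hyx]
  -- A nonzero product through `g j` would be invertible in `g_i R g_i`, so `g i` and `g j` would
  -- generate isomorphic left ideals, which basicness forbids.
  have hzero : ∀ a b j, j ≠ i → g i * a * g j * b * g i = 0 := by
    intro a b j hji
    by_contra h
    obtain ⟨W, hW⟩ := hinv (a * g j * b) (by simpa only [mul_assoc] using h)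
    have hab : (g i * a * g j) * (g j * b * g i * W * g i) = g i := by
      calc _ = g i * a * (g j * g j) * b * g i * W * g i := by simp only [mul_assoc]
        _ = g i * (a * g j * b) * g i * W * g i := by rw [hgg]; simp only [mul_assoc]
        _ = g i := by rw [hW, hgg]
    have ha1 : g i * (g i * a * g j) = g i * a * g j := by simp only [← mul_assoc, hgg]
    have ha2 : (g i * a * g j) * g j = g i * a * g j := by rw [mul_assoc, hgg]
    have hb1 : g j * (g j * b * g i * W * g i) = g j * b * g i * W * g i := by
      simp only [← mul_assoc, hgg]
    have hb2 : (g j * b * g i * W * g i) * g i = g j * b * g i * W * g i := by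
      rw [mul_assoc, hgg]
    generalize g i * a * g j = A at *
    generalize g j * b * g i * W * g i = B at *
    have hba : B * A = g j := by
      refine (hprim j).eq_of_le ?_ (by rw [← mul_assoc, hb1]) (by rw [mul_assoc, ha2]) fun h => ?_
      · rw [mul_assoc, ← mul_assoc A, hab, ha1]
      · apply (hprim i).2.1
        calc g i = A * B * (A * B) := by rw [hab, hgg]
          _ = A * (B * A) * B := by simp only [mul_assoc]
          _ = 0 := by rw [h]; simp
    exact hji (hinj i j (nonempty_span_equiv hab hba (hgg i) (hgg j) ha1 hb1)).symm
  -- Thus compression to `g_i R g_i` is multiplicative: in `a * b = ∑ a g_j b` only the term `j = i`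
  -- survives. It sends idempotents to 0 or `g i`. Both `e` and `f` have nonzero image, since `e = u
  -- f v`, and this contradicts `e * f = 0`.
  have hmul : ∀ a b, g i * (a * b) * g i = (g i * a * g i) * (g i * b * g i) := by
    intro a b
    calc g i * (a * b) * g i = ∑ j, g i * (a * g j * b) * g i := by
          rw [hsum a b, Finset.mul_sum, Finset.sum_mul]
      _ = g i * (a * g i * b) * g i := Finset.sum_eq_single i
          (fun j _ hj => by simpa only [mul_assoc] using hzero a b j hj) (by simp)
      _ = g i * a * (g i * g i) * b * g i := by rw [hgg]; simp only [mul_assoc]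
      _ = _ := by simp only [mul_assoc]
  have hone : ∀ a, a * a = a → g i * a * g i ≠ 0 → g i * a * g i = g i := fun a ha h0 =>
    (hprim i).eq_of_le (by rw [← hmul, ha]) (by simp only [← mul_assoc, hgg])
      (by rw [mul_assoc, hgg]) h0
  have he1 : g i * e * g i ≠ 0 := fun h => hi (by
    calc e * g i * e = e * g i * (e * e) := by rw [he]
      _ = e * g i * e * ((e * g i * e) * (e * w * e)) := by rw [hw]; simp only [mul_assoc]
      _ = e * (g i * (e * e) * g i) * e * (e * w * e) := by simp only [mul_assoc]
      _ = 0 := by rw [he, h]; simp)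
  have hf1 : g i * f * g i ≠ 0 := fun h => he1 (by
    rw [← huv, hmul, hmul, h]; simp)
  have := hmul e f
  rw [hef, hone e he he1, hone f hf hf1, hgg] at this
  exact (hprim i).2.1 (by simpa using this.symm)

namespace SquareFree

open SquareFreeSemigroup

/-! ### Divisibility in a thin semigroup -/

section Thin

variable {S : Type*} [SquareFreeSemigroup S]

/-- This is thinness: `e S f` has at most one nonzero element. Equalities in `S*` thereby reduce to
comparing end idempotents. -/
theorem Nz.ext_of_lft_rgt {s t : Nz S} (hl : lft s = lft t) (hr : rgt s = rgt t) : s = t := by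
  have hs : (lft s).1 * s.1 * (rgt s).1 = s.1 := by rw [lft_mul, mul_rgt]
  have ht : (lft s).1 * t.1 * (rgt s).1 = t.1 := by rw [hl, hr, lft_mul, mul_rgt]
  have := thin _ (lft s).2 _ (rgt s).2 s.1 t.1 (by rw [hs]; exact s.2) (by rw [ht]; exact t.2)
  exact Subtype.ext (by rwa [hs, ht] at this)

instance : Finite (Nz S) :=
  Finite.of_injective (fun s : Nz S => (lft s, rgt s)) fun _ _ h =>
    Nz.ext_of_lft_rgt (congrArg Prod.fst h) (congrArg Prod.snd h)

theorem Idem.star_injective : Function.Injective (Idem.star : Idem S → Nz S) := fun _ _ h =>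
  Subtype.ext (congrArg (fun s : Nz S => s.1) h)

@[simp] theorem lft_star (e : Idem S) : lft e.star = e := lft_eq (idem_star_mul_self e)

@[simp] theorem rgt_star (e : Idem S) : rgt e.star = e := rgt_eq (idem_star_mul_self e)

theorem Nz.eq_star {s : Nz S} {e : Idem S} (hl : lft s = e) (hr : rgt s = e) : s = e.star :=
  Nz.ext_of_lft_rgt (by simpa) (by simpa)

theorem star_mul_ne_zero {e : Idem S} {s : Nz S} : e.star.1 * s.1 ≠ 0 ↔ lft s = e :=
  ⟨fun h => lft_eq h, fun h => by subst h; exact (lft_mul s).symm ▸ s.2⟩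

theorem mul_star_ne_zero {e : Idem S} {s : Nz S} : s.1 * e.star.1 ≠ 0 ↔ rgt s = e :=
  ⟨fun h => rgt_eq h, fun h => by subst h; exact (mul_rgt s).symm ▸ s.2⟩

/-- No idempotent is a product of two elements of `S*` one of which is not idempotent. -/
def NoLoops (S : Type*) [SquareFreeSemigroup S] : Prop :=
  ∀ (s t : Nz S) (e : Idem S), s.1 * t.1 = e.1 → s = e.star ∧ t = e.star

/-- `s` is a proper left divisor of `t`. -/
def Below (s t : Nz S) : Prop := ∃ m : Nz S, (∀ e : Idem S, m ≠ e.star) ∧ s.1 * m.1 = t.1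

/-- `NoLoops` ensures that the product of the two cofactors is not idempotent. -/
theorem Below.trans (hS : NoLoops S) {s t u : Nz S} (h : Below s t) (h' : Below t u) :
    Below s u := by
  obtain ⟨m, hm, hst⟩ := h
  obtain ⟨k, -, htu⟩ := h'
  have hmk : m.1 * k.1 ≠ 0 := fun h0 => u.2 (by rw [← htu, ← hst, mul_assoc, h0, mul_zero])
  refine ⟨m.mul k hmk, fun e he => hm e ?_, ?_⟩
  · exact (hS m k e (congrArg Subtype.val he)).1
  · rw [← htu, ← hst, mul_assoc]; rfl

/-- If `s · m = s`, then `m` has both ends at the right idempotent of `s`, so by thinness it is that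
idempotent. -/
theorem Below.irrefl (s : Nz S) : ¬ Below s s := by
  rintro ⟨m, hm, h⟩
  have h0 : s.1 * m.1 ≠ 0 := by rw [h]; exact s.2
  have h1 : s.mul m h0 = s := Subtype.ext h
  refine hm (rgt s) (Nz.eq_star (rgt_eq_lft h0).symm ?_)
  rw [← rgt_star_mul s m h0, h1]

/-- The number of proper left divisors. -/
noncomputable def height (s : Nz S) : ℕ := {t | Below t s}.ncard

theorem height_lt (hS : NoLoops S) {s t : Nz S} (h : Below s t) : height s < height t :=
  Set.ncard_lt_ncard ⟨fun _ hu => Below.trans hS hu h, fun hsub => Below.irrefl s (hsub h)⟩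
    (Set.toFinite _)

theorem height_lt_card (s : Nz S) : height s < Nat.card (Nz S) := by
  rw [← Set.ncard_univ]
  exact Set.ncard_lt_ncard ⟨Set.subset_univ _, fun h => Below.irrefl s (h (Set.mem_univ s))⟩
    (Set.toFinite _)

end Thin

/-! ### Coefficients and corners of the twisted semigroup ring -/

namespace TwistedRing

variable {S D : Type*} [SquareFreeSemigroup S] [DivisionRing D] {c : TwoCocycle S D}

variable (c) in
/-- The coefficient of an element of `D^α_ξ S` at `s`. -/
noncomputable def coeff (s : Nz S) : TwistedRing c →+ D := Finsupp.applyAddHom s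

theorem coeff_single_same (s : Nz S) (a : D) : coeff c s (single c s a) = a :=
  Finsupp.single_eq_same

theorem coeff_single_of_ne {s t : Nz S} (h : t ≠ s) (a : D) : coeff c s (single c t a) = 0 :=
  Finsupp.single_eq_of_ne h.symm

theorem ext_coeff {x y : TwistedRing c} (h : ∀ s, coeff c s x = coeff c s y) : x = y :=
  Finsupp.ext h

theorem single_injective (s : Nz S) : Function.Injective (single c s) := fun a b h => by
  rw [← coeff_single_same (c := c) s a, h, coeff_single_same]

theorem single_ne_zero {s : Nz S} {a : D} (h : a ≠ 0) : single c s a ≠ 0 := fun h' =>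
  h (single_injective (c := c) s (h'.trans (map_zero _).symm))

theorem sum_single_coeff (x : TwistedRing c) :
    (Finsupp.support (M := D) x).sum (fun s => single c s (coeff c s x)) = x :=
  Finsupp.sum_single (M := D) x

variable (c) in
/-- The unit `ξ(e, e)`. -/
noncomputable def xe (e : Idem S) : Dˣ := c.ξ e.star e.star (idem_star_mul_self e)

theorem xi_star_left {e : Idem S} {s : Nz S} (h : e.star.1 * s.1 ≠ 0) :
    c.ξ e.star s h = xe c e := by
  obtain rfl := star_mul_ne_zero.1 h
  exact xi_left s h

theorem xi_star_right {e : Idem S} {s : Nz S} (h : s.1 * e.star.1 ≠ 0) :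
    c.ξ s e.star h = app (c.α s) (xe c e) := by
  obtain rfl := mul_star_ne_zero.1 h
  exact (xi_right s h).symm

variable (c) in
/-- The embedding of `D` as the corner ring at `e`. -/
noncomputable def emb (e : Idem S) : D →+ TwistedRing c :=
  (single c e.star).comp (AddMonoidHom.mulRight (((xe c e)⁻¹ : Dˣ) : D))

theorem emb_apply (e : Idem S) (d : D) : emb c e d = single c e.star (d * ((xe c e)⁻¹ : Dˣ)) := rfl

theorem single_star (e : Idem S) (d : D) : single c e.star d = emb c e (d * xe c e) := by
  simp [emb_apply]

theorem emb_injective (e : Idem S) : Function.Injective (emb c e) := fun a b h => by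
  simpa using single_injective _ h

/-- The cocycle need not be normal. The factor `ξ(e,e)⁻¹` in `emb` cancels both the twist `α_e =
ρ_{ξ(e,e)}` and `ξ(e,s) = ξ(e,e)`. -/
theorem emb_mul_single (s : Nz S) (d a : D) :
    emb c (lft s) d * single c s a = single c s (d * a) := by
  have h : (lft s).star.1 * s.1 ≠ 0 := star_mul_ne_zero.2 rfl
  have e1 : (lft s).star.mul s h = s := Subtype.ext (lft_mul s)
  rw [emb_apply, single_mul_single h, xi_star_left, alpha_idem, rho_apply, e1]
  congr 1
  simp [xe, mul_assoc]

theorem emb_mul_single_of_ne {e : Idem S} {s : Nz S} (h : lft s ≠ e) (d a : D) :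
    emb c e d * single c s a = 0 :=
  single_mul_single_of_eq (by_contra fun h' => h (star_mul_ne_zero.1 h')) _ _

/-- Here `ξ(e,e)⁻¹` cancels against `ξ(s,e) = α_s(ξ(e,e))`. -/
theorem single_mul_emb (s : Nz S) (d a : D) :
    single c s a * emb c (rgt s) d = single c s (a * c.α s d) := by
  have h : s.1 * (rgt s).star.1 ≠ 0 := mul_star_ne_zero.2 rfl
  have e1 : s.mul (rgt s).star h = s := Subtype.ext (mul_rgt s)
  rw [emb_apply, single_mul_single h, xi_star_right, e1, coe_app, mul_assoc, ← map_mul]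
  simp

theorem single_mul_emb_of_ne {e : Idem S} {s : Nz S} (h : rgt s ≠ e) (d a : D) :
    single c s a * emb c e d = 0 :=
  single_mul_single_of_eq (by_contra fun h' => h (mul_star_ne_zero.1 h')) _ _

theorem emb_mul_emb (e : Idem S) (a b : D) : emb c e a * emb c e b = emb c e (a * b) := by
  have := emb_mul_single (c := c) e.star a (b * ((xe c e)⁻¹ : Dˣ))
  rw [lft_star] at this
  rw [emb_apply e b, this, emb_apply, mul_assoc]

theorem emb_mul_emb_of_ne {e f : Idem S} (h : e ≠ f) (a b : D) : emb c e a * emb c f b = 0 :=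
  emb_mul_single_of_ne (by simpa using h.symm) _ _

theorem sum_emb_one : ∑ e : Idem S, emb c e 1 = 1 := by
  change _ = oneElem c
  simp [emb_apply, oneElem, xe]

theorem emb_one_ne_zero (e : Idem S) : emb c e 1 ≠ 0 := fun h =>
  one_ne_zero (emb_injective (c := c) e (h.trans (map_zero _).symm))

theorem coeff_emb_mul_of_ne {e : Idem S} {s : Nz S} (h : lft s ≠ e) (d : D) (x : TwistedRing c) :
    coeff c s (emb c e d * x) = 0 := by
  induction x using induction with
  | h0 => simp
  | hadd x y hx hy => rw [mul_add, map_add, hx, hy, add_zero]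
  | hs t a =>
    by_cases ht : lft t = e
    · subst ht
      rw [emb_mul_single, coeff_single_of_ne]
      rintro rfl
      exact h rfl
    · rw [emb_mul_single_of_ne ht, map_zero]

theorem coeff_mul_emb_of_ne {e : Idem S} {s : Nz S} (h : rgt s ≠ e) (d : D) (x : TwistedRing c) :
    coeff c s (x * emb c e d) = 0 := by
  induction x using induction with
  | h0 => simp
  | hadd x y hx hy => rw [add_mul, map_add, hx, hy, add_zero]
  | hs t a =>
    by_cases ht : rgt t = e
    · subst ht
      rw [single_mul_emb, coeff_single_of_ne]
      rintro rfl
      exact h rfl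
    · rw [single_mul_emb_of_ne ht, map_zero]

/-- The corner at `(e, f)` is at most one-dimensional. -/
theorem exists_eq_single {e f : Idem S} {x : TwistedRing c} (hl : emb c e 1 * x = x)
    (hr : x * emb c f 1 = x) (hx : x ≠ 0) :
    ∃ (s : Nz S) (a : Dˣ), lft s = e ∧ rgt s = f ∧ x = single c s a := by
  obtain ⟨s, hs⟩ : ∃ s, coeff c s x ≠ 0 := by
    by_contra! h
    exact hx (ext_coeff fun s => by rw [h s, map_zero])
  have key : ∀ t, coeff c t x ≠ 0 → lft t = e ∧ rgt t = f := fun t ht => by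
    constructor
    · by_contra h
      exact ht (by rw [← hl, coeff_emb_mul_of_ne h])
    · by_contra h
      exact ht (by rw [← hr, coeff_mul_emb_of_ne h])
  refine ⟨s, Units.mk0 _ hs, (key s hs).1, (key s hs).2, ext_coeff fun t => ?_⟩
  by_cases hts : s = t
  · subst hts
    rw [coeff_single_same]; rfl
  · rw [coeff_single_of_ne hts]
    by_contra ht
    exact hts (Nz.ext_of_lft_rgt ((key s hs).1.trans (key t ht).1.symm)
      ((key s hs).2.trans (key t ht).2.symm))

/-- By thinness `e` is the only nonzero element of `e S e`, so this corner is a copy of `D`. -/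
theorem emb_one_mul_mul (e : Idem S) (x : TwistedRing c) :
    ∃ d : D, emb c e 1 * x * emb c e 1 = emb c e d := by
  by_cases h : emb c e 1 * x * emb c e 1 = 0
  · exact ⟨0, by rw [h, map_zero]⟩
  · obtain ⟨s, a, hl, hr, hs⟩ := exists_eq_single (e := e) (f := e)
      (x := emb c e 1 * x * emb c e 1)
      (by simp only [← mul_assoc, emb_mul_emb, mul_one])
      (by simp only [mul_assoc, emb_mul_emb, mul_one]) h
    obtain rfl := Nz.eq_star hl hr
    exact ⟨_, hs.trans (single_star e _)⟩

/-- If `s · t = e` passes through an idempotent other than `e`, then the corner identity at `e`,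
whose corner is `D`, factors through an orthogonal idempotent. A basic ring excludes this. -/
theorem noLoops {R : Type*} [Ring R] (hR : IsBasicRing R) (g : R ≃+* TwistedRing c) :
    NoLoops S := by
  intro s t e hst
  have h0 : s.1 * t.1 ≠ 0 := by rw [hst]; exact ne_zero_of_mem e.1 e.2
  have hmul : s.mul t h0 = e.star := Subtype.ext hst
  have hl : lft s = e := by rw [← lft_star_mul s t h0, hmul, lft_star]
  have hr : rgt t = e := by rw [← rgt_star_mul s t h0, hmul, rgt_star]
  by_cases hef : rgt s = e
  · exact ⟨Nz.eq_star hl hef, Nz.eq_star ((rgt_eq_lft h0).symm.trans hef) hr⟩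
  · exfalso
    have hdiv : ∀ x : TwistedRing c, emb c e 1 * x * emb c e 1 ≠ 0 →
        ∃ w, (emb c e 1 * x * emb c e 1) * (emb c e 1 * w * emb c e 1) = emb c e 1 := by
      intro x hx
      obtain ⟨d, hd⟩ := emb_one_mul_mul e x
      have hd0 : d ≠ 0 := by rintro rfl; exact hx (by rw [hd, map_zero])
      exact ⟨emb c e d⁻¹, by simp [hd, emb_mul_emb, hd0]⟩
    refine emb_one_ne_zero (c := c) e ?_
    have := hR.eq_zero_of_factor (e := g.symm (emb c e 1)) (f := g.symm (emb c (rgt s) 1))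
      (u := g.symm (single c s 1))
      -- The scalar solves `α_s(b) ξ(s,t) = ξ(e,e)⁻¹`, so that the product is exactly the corner
      -- identity at `e`.
      (v := g.symm (single c t ((c.α s).symm (((xe c e)⁻¹ : Dˣ) * ((c.ξ s t h0)⁻¹ : Dˣ)))))
      ?_ ?_ ?_ ?_ ?_
    · simpa using this
    · rw [← map_mul, emb_mul_emb, mul_one]
    · rw [← map_mul, emb_mul_emb, mul_one]
    · rw [← map_mul, emb_mul_emb_of_ne (Ne.symm hef), map_zero]
    · rw [← map_mul, ← map_mul, single_mul_emb, map_one, mul_one, single_mul_single h0, hmul,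
        RingEquiv.apply_symm_apply, emb_apply]
      simp
    · intro x hx
      obtain ⟨w, hw⟩ := hdiv (g x) fun h => hx (g.injective (by simpa using h))
      exact ⟨g.symm w, g.injective (by simpa using hw)⟩

/-! ### Diagonal projections and nilpotent elements -/

/-- Under `NoLoops`, the projection of `D^α_ξ S` onto the corner `D` at `e` is a ring
homomorphism. -/
noncomputable def proj (hS : NoLoops S) (c : TwoCocycle S D) (e : Idem S) :
    TwistedRing c →+* D where
  -- The factor `ξ(e,e)` undoes the normalization of `emb`.
  toFun := fun x => coeff c e.star x * xe c e
  map_one' := by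
    rw [← sum_emb_one, map_sum, Finset.sum_eq_single e, emb_apply, coeff_single_same]
    · simp
    · intro f _ hf
      exact coeff_single_of_ne (fun h => hf (Idem.star_injective h)) _
    · simp
  map_mul' := fun x y => by
    induction x using induction with
    | h0 => simp
    | hadd x x' hx hx' => simp only [add_mul, map_add, hx, hx']
    | hs s a =>
      induction y using induction with
      | h0 => simp
      | hadd x x' hx hx' => simp only [mul_add, add_mul, map_add, hx, hx']
      | hs t b =>
        -- By `NoLoops` the only product of basis elements that reaches `e` is `e · e`.
        by_cases h : s.1 * t.1 = e.1
        · obtain ⟨rfl, rfl⟩ := hS s t e h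
          rw [single_star, single_star, emb_mul_emb, emb_apply, emb_apply, emb_apply]
          simp only [coeff_single_same]
          simp [mul_assoc]
        · have h1 : coeff c e.star (single c s a * single c t b) = 0 := by
            by_cases h0 : s.1 * t.1 = 0
            · rw [single_mul_single_of_eq h0, map_zero]
            · rw [single_mul_single h0, coeff_single_of_ne]
              exact fun h' => h (congrArg Subtype.val h')
          rw [h1, zero_mul]
          by_cases hs : s = e.star
          · by_cases ht : t = e.star
            · subst hs ht
              exact absurd (idem e.1 e.2) h
            · rw [coeff_single_of_ne ht, zero_mul, mul_zero]
          · rw [coeff_single_of_ne hs, zero_mul, zero_mul]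
  map_zero' := by rw [map_zero, zero_mul]
  map_add' := fun x y => by rw [map_add, add_mul]

theorem proj_apply (hS : NoLoops S) (e : Idem S) (x : TwistedRing c) :
    proj hS c e x = coeff c e.star x * xe c e := rfl

theorem proj_emb (hS : NoLoops S) (e : Idem S) (d : D) : proj hS c e (emb c e d) = d := by
  rw [proj_apply, emb_apply, coeff_single_same]; simp

variable (c) in
/-- The elements supported in height at least `k`. -/
noncomputable def deep (k : ℕ) : AddSubgroup (TwistedRing c) :=
  AddSubgroup.closure {x | ∃ s a, k ≤ height s ∧ x = single c s a}

/-- With no idempotent in its support, `y` multiplies each basis element into proper right multiples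
of it, which have strictly larger height. -/
theorem mul_mem_deep (hS : NoLoops S) {k : ℕ} {x y : TwistedRing c} (hx : x ∈ deep c k)
    (hy : ∀ e, proj hS c e y = 0) : x * y ∈ deep c (k + 1) := by
  induction hx using AddSubgroup.closure_induction with
  | zero => rw [zero_mul]; exact zero_mem _
  | add x z _ _ hx hz => rw [add_mul]; exact add_mem hx hz
  | neg x _ hx => rw [neg_mul]; exact neg_mem hx
  | mem x hx =>
    obtain ⟨s, a, hk, rfl⟩ := hx
    rw [← sum_single_coeff y, Finset.mul_sum]
    refine sum_mem fun t _ => ?_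
    by_cases h0 : s.1 * t.1 = 0
    · rw [single_mul_single_of_eq h0]; exact zero_mem _
    · by_cases ht : ∃ e : Idem S, t = e.star
      · obtain ⟨e, rfl⟩ := ht
        have : coeff c e.star y = 0 := by simpa [proj_apply] using hy e
        rw [this, map_zero, mul_zero]
        exact zero_mem _
      · rw [single_mul_single h0]
        refine AddSubgroup.subset_closure ⟨_, _, ?_, rfl⟩
        exact hk.trans_lt (height_lt hS ⟨t, not_exists.1 ht, rfl⟩)

/-- A division ring has no nonzero nilpotents. Conversely, `x ^ k` is supported in height at least
`k`, while heights are bounded by the size of `S*`. -/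
theorem isNilpotent_iff (hS : NoLoops S) (x : TwistedRing c) :
    IsNilpotent x ↔ ∀ e, proj hS c e x = 0 := by
  refine ⟨fun h e => (h.map (proj hS c e)).eq_zero, fun h => ⟨Nat.card (Nz S), ?_⟩⟩
  have key : ∀ k, x ^ k ∈ deep c k := by
    intro k
    induction k with
    | zero =>
      rw [← sum_single_coeff (x ^ 0)]
      exact sum_mem fun s _ => AddSubgroup.subset_closure ⟨s, _, Nat.zero_le _, rfl⟩
    | succ k ih => rw [pow_succ]; exact mul_mem_deep hS ih h
  have hbot : deep c (Nat.card (Nz S)) = ⊥ := by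
    rw [deep, AddSubgroup.closure_eq_bot_iff]
    rintro _ ⟨s, a, hk, -⟩
    exact absurd (height_lt_card s) hk.not_gt
  simpa [hbot] using key (Nat.card (Nz S))

/-! ### Monomial automorphisms -/

theorem carries_apply {p : OneCochain S D} {b d : TwoCocycle S D} (hp : Carries p b d) (s : Nz S)
    (x : D) : p.μ (lft s) (d.α s x) * p.η s = p.η s * b.α s (p.μ (rgt s) x) := by
  have h := congrArg (fun f : RingAut D => f (p.μ (rgt s) x)) (hp.1 s)
  simp only [RingAut.mul_apply, rho_apply, RingAut.inv_apply, RingEquiv.symm_apply_apply] at h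
  rw [h]
  simp

theorem Nz.map_map_inv (φ : S ≃* S) (s : Nz S) : (s.map φ).map φ⁻¹ = s :=
  Subtype.ext (φ.symm_apply_apply s.1)

theorem Nz.map_inv_map (φ : S ≃* S) (s : Nz S) : (s.map φ⁻¹).map φ = s :=
  Subtype.ext (φ.apply_symm_apply s.1)

/-- The additive map `a s ↦ μ_e(a) η(s) φ(s)` for `s = e · s`. -/
noncomputable def monomialHom (c : TwoCocycle S D) (φ : S ≃* S) (p : OneCochain S D) :
    TwistedRing c →+ TwistedRing c :=
  lift c fun s => (single c (s.map φ)).comp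
    ((AddMonoidHom.mulRight (p.η s : D)).comp (p.μ (lft s) : D ≃+* D).toAddEquiv.toAddMonoidHom)

theorem monomialHom_single (φ : S ≃* S) (p : OneCochain S D) (s : Nz S) (a : D) :
    monomialHom c φ p (single c s a) = single c (s.map φ) (p.μ (lft s) a * p.η s) :=
  lift_single c _ s a

/-- The additive inverse of `monomialHom`. -/
noncomputable def monomialInv (c : TwoCocycle S D) (φ : S ≃* S) (p : OneCochain S D) :
    TwistedRing c →+ TwistedRing c :=
  lift c fun t => (single c (t.map φ⁻¹)).comp
    ((p.μ (lft (t.map φ⁻¹))).symm.toAddEquiv.toAddMonoidHom.comp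
      (AddMonoidHom.mulRight (((p.η (t.map φ⁻¹))⁻¹ : Dˣ) : D)))

theorem monomialInv_single (φ : S ≃* S) (p : OneCochain S D) (t : Nz S) (b : D) :
    monomialInv c φ p (single c t b) = single c (t.map φ⁻¹)
      ((p.μ (lft (t.map φ⁻¹))).symm (b * ((p.η (t.map φ⁻¹))⁻¹ : Dˣ))) :=
  lift_single c _ t b

/-- The ring automorphism `a s ↦ μ_e(a) η(s) φ(s)` of `D^α_ξ S`. -/
noncomputable def monomialEquiv (φ : S ≃* S) (p : OneCochain S D)
    (hp : Carries p (c.precomp φ) c) : TwistedRing c ≃+* TwistedRing c where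
  toFun := monomialHom c φ p
  invFun := monomialInv c φ p
  left_inv x := by
    induction x using induction with
    | h0 => simp
    | hadd x y hx hy => rw [map_add, map_add, hx, hy]
    | hs s a =>
      rw [monomialHom_single, monomialInv_single, Nz.map_map_inv]
      simp
  right_inv x := by
    induction x using induction with
    | h0 => simp
    | hadd x y hx hy => rw [map_add, map_add, hx, hy]
    | hs s a =>
      rw [monomialInv_single, monomialHom_single, Nz.map_inv_map]
      simp
  map_add' := map_add _
  map_mul' x y := by
    induction x using induction with
    | h0 => simp
    | hadd x x' hx hx' => simp only [add_mul, map_add, hx, hx']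
    | hs s a =>
      induction y using induction with
      | h0 => simp
      | hadd x x' hx hx' => simp only [mul_add, map_add, hx, hx']
      | hs t b =>
        rw [monomialHom_single, monomialHom_single]
        by_cases h : s.1 * t.1 = 0
        · rw [single_mul_single_of_eq h, single_mul_single_of_eq, map_zero]
          change φ s.1 * φ t.1 = 0
          rw [← map_mul, h, map_zero]
        · rw [single_mul_single h, single_mul_single (map_mul_ne_zero φ h), monomialHom_single,
            star_map_mul, lft_star_mul]
          congr 1
          -- The two relations in `Carries` are what is needed: `h1` moves `η(s)` past the twist of
          -- `b`, and `h2` matches the cocycle factors.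
          have h1 := carries_apply hp s b
          have h2 := congrArg (fun v : Dˣ => (v : D) * p.η (s.mul t h)) (hp.2 s t h)
          simp only [Units.val_mul, coe_app, Units.inv_mul_cancel_right] at h2
          rw [rgt_eq_lft h] at h1
          change _ = p.μ (lft s) a * p.η s * (c.precomp φ).α s (p.μ (lft t) b * p.η t) *
            (c.precomp φ).ξ s t h
          rw [map_mul, map_mul, map_mul, mul_assoc (_ * _) (p.μ (lft s) _), h2]
          calc p.μ (lft s) a * p.μ (lft s) (c.α s b) *
                (p.η s * (c.precomp φ).α s (p.η t) * (c.precomp φ).ξ s t h)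
              = p.μ (lft s) a * (p.μ (lft s) (c.α s b) * p.η s) * (c.precomp φ).α s (p.η t) *
                (c.precomp φ).ξ s t h := by simp only [mul_assoc]
            _ = _ := by rw [h1]; simp only [mul_assoc]

theorem monomialEquiv_single {φ : S ≃* S} {p : OneCochain S D} (hp : Carries p (c.precomp φ) c)
    (s : Nz S) (a : D) :
    monomialEquiv φ p hp (single c s a) = single c (s.map φ) (p.μ (lft s) a * p.η s) :=
  monomialHom_single φ p s a

/-! ### Reduction of automorphisms to monomial ones -/

/-- Automorphisms permuting the idempotents `e` are monomial. -/
theorem exists_monomial (γ : TwistedRing c ≃+* TwistedRing c) (π : Equiv.Perm (Idem S))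
    (hγ : ∀ e, γ (emb c e 1) = emb c (π e) 1) :
    ∃ (φ : S ≃* S) (p : OneCochain S D), Carries p (c.precomp φ) c ∧
      ∀ s a, γ (single c s a) = single c (s.map φ) (p.μ (lft s) a * p.η s) := by
  -- Stated for arbitrary `δ` and `σ` so as to apply to `γ` with `π` and, through `hemb`, to
  -- `γ.symm` with `π.symm`.
  have hcorner : ∀ (δ : TwistedRing c ≃+* TwistedRing c) (σ : Equiv.Perm (Idem S)),
      (∀ e, δ (emb c e 1) = emb c (σ e) 1) → ∀ (s : Nz S) (a : D), a ≠ 0 →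
      ∃ (t : Nz S) (b : Dˣ), lft t = σ (lft s) ∧ rgt t = σ (rgt s) ∧
        δ (single c s a) = single c t b := by
    intro δ σ hδ s a ha
    apply exists_eq_single
    · rw [← hδ, ← map_mul, emb_mul_single, one_mul]
    · rw [← hδ, ← map_mul, single_mul_emb, map_one, mul_one]
    · rw [Ne, map_eq_zero_iff δ δ.injective]
      exact single_ne_zero ha
  have hemb : ∀ (δ : TwistedRing c ≃+* TwistedRing c) (σ : Equiv.Perm (Idem S)),
      (∀ e, δ (emb c e 1) = emb c (σ e) 1) → ∀ e d, ∃ d', δ (emb c e d) = emb c (σ e) d' := by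
    intro δ σ hδ e d
    by_cases hd : d = 0
    · exact ⟨0, by simp [hd]⟩
    · obtain ⟨t, b, hl, hr, h⟩ := hcorner δ σ hδ e.star (d * ((xe c e)⁻¹ : Dˣ)) (by simp [hd])
      rw [lft_star] at hl
      rw [rgt_star] at hr
      obtain rfl := Nz.eq_star hl hr
      exact ⟨_, h.trans (single_star _ _)⟩
  have hγs : ∀ e, γ.symm (emb c e 1) = emb c (π.symm e) 1 := fun e => by
    rw [RingEquiv.symm_apply_eq, hγ, Equiv.apply_symm_apply]
  choose m hm using hemb γ π hγ
  let μ₀ : Idem S → D →+* D := fun e =>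
    { toFun := m e
      map_one' := emb_injective (c := c) (π e) (by rw [← hm, hγ])
      map_zero' := emb_injective (c := c) (π e) (by rw [← hm, map_zero, map_zero, map_zero])
      map_add' := fun x y => emb_injective (c := c) (π e) (by
        rw [← hm, map_add, map_add, map_add, hm, hm])
      map_mul' := fun x y => emb_injective (c := c) (π e) (by
        rw [← hm, ← emb_mul_emb, ← emb_mul_emb, map_mul, hm, hm]) }
  -- Surjectivity comes from `γ.symm`, which maps the corner at `π e` back to the one at `e`.
  have hbij : ∀ e, Function.Bijective (μ₀ e) := fun e => ⟨(μ₀ e).injective, fun d => by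
    obtain ⟨d', hd'⟩ := hemb γ.symm π.symm hγs (π e) d
    rw [Equiv.symm_apply_apply, RingEquiv.symm_apply_eq, hm] at hd'
    exact ⟨d', (emb_injective _ hd').symm⟩⟩
  choose f η hl hr hf using fun s => hcorner γ π hγ s 1 one_ne_zero
  have hsingle : ∀ s a, γ (single c s a) = single c (f s) (m (lft s) a * η s) := fun s a => by
    have := emb_mul_single (c := c) s a 1
    rw [mul_one] at this
    rw [← this, map_mul, hm, hf, ← hl, emb_mul_single]
  have hfinj : Function.Injective f := fun s t h => Nz.ext_of_lft_rgt
    (π.injective (by rw [← hl, ← hl, h])) (π.injective (by rw [← hr, ← hr, h]))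
  have hfsurj : Function.Surjective f := Finite.surjective_of_injective hfinj
  -- A product of two nonzero multiples of basis elements vanishes exactly when the semigroup
  -- product does, and `γ` preserves vanishing.
  have hne : ∀ s t : Nz S, s.1 * t.1 ≠ 0 ↔ (f s).1 * (f t).1 ≠ 0 := by
    intro s t
    have key : γ (single c s 1 * single c t 1) = single c (f s) (η s) * single c (f t) (η t) := by
      rw [map_mul, hf, hf]
    refine not_congr ⟨fun h => ?_, fun h => ?_⟩
    · by_contra h'
      rw [single_mul_single_of_eq h, map_zero, single_mul_single h'] at key
      exact single_ne_zero (by simp) key.symm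
    · by_contra h'
      rw [single_mul_single_of_eq h, single_mul_single h', map_eq_zero_iff γ γ.injective] at key
      exact single_ne_zero (by simp) key
  have hmul : ∀ (s t : Nz S) (h : s.1 * t.1 ≠ 0),
      f (s.mul t h) = (f s).mul (f t) ((hne s t).1 h) := fun s t h => Nz.ext_of_lft_rgt
    (by rw [hl, lft_star_mul, lft_star_mul, hl]) (by rw [hr, rgt_star_mul, rgt_star_mul, hr])
  classical
  -- Extending `f` by `0 ↦ 0` gives the semigroup automorphism.
  let φ₀ : S → S := fun s => if h : s = 0 then 0 else (f ⟨s, h⟩).1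
  have hφ₀ : ∀ s : Nz S, φ₀ s.1 = (f s).1 := fun s => dif_neg s.2
  have hφz : φ₀ 0 = 0 := dif_pos rfl
  have hφbij : Function.Bijective φ₀ := by
    constructor
    · intro s t h
      by_cases hs : s = 0 <;> by_cases ht : t = 0
      · rw [hs, ht]
      · rw [hs, hφz, hφ₀ ⟨t, ht⟩] at h
        exact absurd h.symm (f _).2
      · rw [ht, hφz, hφ₀ ⟨s, hs⟩] at h
        exact absurd h (f _).2
      · rw [hφ₀ ⟨s, hs⟩, hφ₀ ⟨t, ht⟩] at h
        exact congrArg Subtype.val (hfinj (Subtype.ext h))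
    · intro t
      by_cases ht : t = 0
      · exact ⟨0, by rw [hφz, ht]⟩
      · obtain ⟨s, hs⟩ := hfsurj ⟨t, ht⟩
        exact ⟨s.1, by rw [hφ₀, hs]⟩
  let φ : S ≃* S := MulEquiv.ofBijective (⟨φ₀, fun s t => by
    by_cases hs : s = 0
    · rw [hs, zero_mul, hφz, zero_mul]
    by_cases ht : t = 0
    · rw [ht, mul_zero, hφz, mul_zero]
    rw [hφ₀ ⟨s, hs⟩, hφ₀ ⟨t, ht⟩]
    by_cases h : s * t = 0
    · rw [h, hφz]
      by_contra h'
      exact (hne ⟨s, hs⟩ ⟨t, ht⟩).2 (Ne.symm h') h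
    · rw [hφ₀ ⟨s * t, h⟩]
      exact congrArg Subtype.val (hmul ⟨s, hs⟩ ⟨t, ht⟩ h)⟩ : S →ₙ* S) hφbij
  have hφ : ∀ s : Nz S, s.map φ = f s := fun s => Subtype.ext (hφ₀ s)
  have hsm : ∀ s a, γ (single c s a) = single c (s.map φ) (m (lft s) a * η s) := fun s a => by
    rw [hφ, hsingle]
  refine ⟨φ, ⟨fun e => RingEquiv.ofBijective (μ₀ e) (hbij e), η⟩, ⟨fun s => ?_, fun s t h => ?_⟩,
    hsm⟩
  -- Apply `γ` to `s · d = α_s(d) s`, with `d` in the right corner of `s`.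
  · have key : ∀ x, m (lft s) (c.α s x) * η s = η s * c.α (s.map φ) (m (rgt s) x) := fun x => by
      apply single_injective (c := c) (s.map φ)
      rw [← hsm, ← one_mul (c.α s x), ← single_mul_emb, map_mul, hm, hf, ← hr, single_mul_emb, hφ]
    rw [mul_inv_eq_iff_eq_mul]
    ext x
    change m (lft s) (c.α s x) = η s * c.α (s.map φ) (m (rgt s) x) * ((η s)⁻¹ : Dˣ)
    rw [← key]; simp
  -- Apply `γ` to `s t = ξ(s,t) (s · t)`.
  · have key : m (lft s) (c.ξ s t h) * η (s.mul t h) =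
        η s * c.α (s.map φ) (η t) * c.ξ (s.map φ) (t.map φ) (map_mul_ne_zero φ h) := by
      apply single_injective (c := c) ((s.mul t h).map φ)
      have := hsm (s.mul t h) (c.ξ s t h)
      rw [lft_star_mul] at this
      rw [← this, star_map_mul, ← single_mul_single, hφ, hφ, ← hf, ← hf, ← map_mul,
        single_mul_single h]
      simp
    ext
    rw [coe_app, Units.val_mul, Units.eq_mul_inv_iff_mul_eq]
    exact key

/-- Every automorphism agrees with a monomial one up to an inner automorphism. -/
theorem exists_conj_monomial (hS : NoLoops S) (γ : TwistedRing c ≃+* TwistedRing c) :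
    ∃ (u : (TwistedRing c)ˣ) (φ : S ≃* S) (p : OneCochain S D), Carries p (c.precomp φ) c ∧
      ∀ s a, u * γ (single c s a) * (u⁻¹ : (TwistedRing c)ˣ) =
        single c (s.map φ) (p.μ (lft s) a * p.η s) := by
  have hidem : ∀ e f, proj hS c f (γ (emb c e 1)) = 0 ∨ proj hS c f (γ (emb c e 1)) = 1 := by
    intro e f
    apply IsIdempotentElem.iff_eq_zero_or_one.1
    change _ * _ = _
    rw [← map_mul, ← map_mul, emb_mul_emb, mul_one]
  -- The images of the corner identities in `D` are orthogonal idempotents with sum 1, so exactly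
  -- one of them is 1.
  have hex : ∀ f, ∃ e, proj hS c f (γ (emb c e 1)) = 1 := by
    intro f
    by_contra! h
    apply one_ne_zero (α := D)
    rw [← map_one (proj hS c f), ← map_one γ, ← sum_emb_one, map_sum, map_sum]
    exact Finset.sum_eq_zero fun e _ => (hidem e f).resolve_right (h e)
  choose σ hσ using hex
  have hσ0 : ∀ e f, e ≠ σ f → proj hS c f (γ (emb c e 1)) = 0 := by
    intro e f h
    rw [← mul_one (proj hS c f _), ← hσ f, ← map_mul, ← map_mul, emb_mul_emb_of_ne h, map_zero,
      map_zero]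
  have hσs : Function.Surjective σ := by
    intro e
    by_contra! h
    -- An idempotent missed by `σ` would have nilpotent image under `γ`, hence would be nilpotent
    -- itself.
    have h1 : IsNilpotent (γ (emb c e 1)) :=
      (isNilpotent_iff hS _).2 fun f => hσ0 e f (h f).symm
    have h2 : IsNilpotent (emb c e 1) := by simpa using h1.map γ.symm
    have := (isNilpotent_iff hS _).1 h2 e
    rw [proj_emb] at this
    exact one_ne_zero this
  let τ : Equiv.Perm (Idem S) := Equiv.ofBijective σ (Finite.surjective_iff_bijective.1 hσs)
  -- The standard element intertwining two complete families of orthogonal idempotents: `e_f u = u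
  -- γ(e_{σ f})`.
  set u : TwistedRing c := ∑ f, emb c f 1 * γ (emb c (σ f) 1) with hu
  have hl : ∀ f, emb c f 1 * u = emb c f 1 * γ (emb c (σ f) 1) := fun f => by
    rw [hu, Finset.mul_sum, Finset.sum_eq_single f]
    · rw [← mul_assoc, emb_mul_emb, mul_one]
    · intro g _ hg
      rw [← mul_assoc, emb_mul_emb_of_ne hg.symm, zero_mul]
    · simp
  have hr : ∀ f, u * γ (emb c (σ f) 1) = emb c f 1 * γ (emb c (σ f) 1) := fun f => by
    rw [hu, Finset.sum_mul, Finset.sum_eq_single f]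
    · rw [mul_assoc, ← map_mul, emb_mul_emb, mul_one]
    · intro g _ hg
      have hgf : σ g ≠ σ f := fun h => hg (τ.injective h)
      rw [mul_assoc, ← map_mul, emb_mul_emb_of_ne hgf, map_zero, mul_zero]
    · simp
  have hunit : IsUnit u := by
    -- Every diagonal projection of `u` is 1, since `σ f` was chosen so that `γ(e_{σ f})` projects
    -- to 1 at `f`.
    have : IsNilpotent (u - 1) := (isNilpotent_iff hS _).2 fun f => by
      have h := congrArg (proj hS c f) (hl f)
      rw [map_mul, map_mul, proj_emb, hσ, one_mul, one_mul] at h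
      rw [map_sub, h, map_one, sub_self]
    simpa using this.isUnit_add_one
  obtain ⟨v, hv⟩ := hunit
  let γ' : TwistedRing c ≃+* TwistedRing c :=
    { toFun := fun x => v * γ x * (v⁻¹ : (TwistedRing c)ˣ)
      invFun := fun x => γ.symm ((v⁻¹ : (TwistedRing c)ˣ) * x * v)
      left_inv := fun x => by simp [mul_assoc]
      right_inv := fun x => by simp [mul_assoc]
      map_mul' := fun x y => by simp [mul_assoc]
      map_add' := fun x y => by simp [mul_add, add_mul] }
  obtain ⟨φ, p, hp, h⟩ := exists_monomial γ' τ.symm (fun e => by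
    change v * γ (emb c e 1) * ((v⁻¹ : (TwistedRing c)ˣ) : TwistedRing c) = _
    rw [Units.mul_inv_eq_iff_eq_mul, hv]
    obtain ⟨f, rfl⟩ := τ.surjective e
    rw [Equiv.symm_apply_apply, hl]
    exact hr f)
  exact ⟨v, φ, p, hp, h⟩

/-! ### Inner monomial automorphisms -/

/-- If `t · s = s`, then both ends of `t` are the left idempotent of `s`, so `t` is that idempotent.
Only the diagonal part of `r` contributes. -/
theorem coeff_mul_single (hS : NoLoops S) (s : Nz S) (r : TwistedRing c) (a : D) :
    coeff c s (r * single c s a) = proj hS c (lft s) r * a := by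
  induction r using induction with
  | h0 => simp
  | hadd x y hx hy => rw [add_mul, map_add, hx, hy, map_add, add_mul]
  | hs t b =>
    by_cases ht : t = (lft s).star
    · subst ht
      rw [single_star, emb_mul_single, coeff_single_same, proj_emb]
    · rw [proj_apply, coeff_single_of_ne ht, zero_mul, zero_mul]
      by_cases h : t.1 * s.1 = 0
      · rw [single_mul_single_of_eq h, map_zero]
      · rw [single_mul_single h, coeff_single_of_ne]
        intro h'
        refine ht (Nz.eq_star ?_ (rgt_eq_lft h))
        rw [← lft_star_mul t s h, h']

theorem coeff_single_mul (hS : NoLoops S) (s : Nz S) (r : TwistedRing c) (a : D) :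
    coeff c s (single c s a * r) = a * c.α s (proj hS c (rgt s) r) := by
  induction r using induction with
  | h0 => simp
  | hadd x y hx hy => rw [mul_add, map_add, hx, hy, map_add, map_add, mul_add]
  | hs t b =>
    by_cases ht : t = (rgt s).star
    · subst ht
      rw [single_star, single_mul_emb, coeff_single_same, proj_emb]
    · rw [proj_apply, coeff_single_of_ne ht, zero_mul, map_zero, mul_zero]
      by_cases h : s.1 * t.1 = 0
      · rw [single_mul_single_of_eq h, map_zero]
      · rw [single_mul_single h, coeff_single_of_ne]
        intro h'
        refine ht (Nz.eq_star (rgt_eq_lft h).symm ?_)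
        rw [← rgt_star_mul s t h, h']

/-- Elements of `S*` are determined by their end idempotents. -/
theorem mulEquiv_eq_one {φ : MulAut S} (h : ∀ e : Idem S, e.map φ = e) : φ = 1 := by
  ext s
  by_cases hs : s = 0
  · rw [hs, map_zero, map_zero]
  · have : Nz.map φ ⟨s, hs⟩ = ⟨s, hs⟩ :=
      Nz.ext_of_lft_rgt (by rw [lft_map, h]) (by rw [rgt_map, h])
    exact congrArg Subtype.val this

theorem Nz.map_one (s : Nz S) : s.map (1 : MulAut S) = s := rfl

/-- If a monomial automorphism is inner then it is trivial on `S` and given by a coboundary. -/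
theorem eq_starAct_of_inner (hS : NoLoops S) {φ : MulAut S} {p : OneCochain S D}
    {r : (TwistedRing c)ˣ}
    (h : ∀ s a, single c (s.map φ) (p.μ (lft s) a * p.η s) * r = r * single c s a) :
    φ = 1 ∧ ∃ ε : Idem S → Dˣ, starAct c ε 1 = p := by
  -- The diagonal part of `r` is the candidate cochain; its entries are units because the
  -- projections are ring homomorphisms.
  let ε : Idem S → Dˣ := fun e => Units.map (proj hS c e : TwistedRing c →* D) r
  have hε : ∀ e, (ε e : D) = proj hS c e r := fun _ => rfl
  have hφ : φ = 1 := mulEquiv_eq_one fun e => by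
    by_contra hne
    -- At `e` the right side has coefficient `ε(e) ξ(e,e)⁰ = ε(e)`, a unit, while the left side lies
    -- in the row of `φ(e)` and has coefficient 0 there if `φ(e) ≠ e`.
    have h1 := congrArg (coeff c e.star) (h e.star 1)
    have h2 : (e.star.map φ) = (e.map φ).star := rfl
    rw [coeff_mul_single hS, h2, single_star, coeff_emb_mul_of_ne, lft_star, ← hε] at h1
    · exact (ε e).ne_zero (by simpa using h1.symm)
    · rw [lft_star]; exact Ne.symm hne
  subst hφ
  -- Setting `a = 1` determines `η`; then taking `s = e` forces `μ_e = ρ_{ε(e)}`.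
  have key : ∀ s a, p.μ (lft s) a * p.η s * c.α s (ε (rgt s)) = ε (lft s) * a := fun s a => by
    have := congrArg (coeff c s) (h s a)
    rwa [Nz.map_one, coeff_mul_single hS, coeff_single_mul hS] at this
  have hη : ∀ s, p.η s * app (c.α s) (ε (rgt s)) = ε (lft s) := fun s => by
    ext
    have := key s 1
    rwa [map_one, one_mul, mul_one] at this
  refine ⟨rfl, ε, OneCochain.ext ?_ ?_⟩
  · funext e
    ext a
    have h1 := key e.star a
    have h2 := congrArg (fun v : Dˣ => (v : D)) (hη e.star)
    simp only [lft_star, rgt_star, Units.val_mul, coe_app] at h1 h2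
    rw [mul_assoc, h2] at h1
    simp only [starAct, OneCochain.one_μ, mul_one, rho_apply]
    rw [← h1]; simp
  · funext s
    simp only [starAct, OneCochain.one_η, mul_one]
    rw [← hη, map_inv]; simp

/-- Monomial automorphisms given by coboundaries are inner. -/
theorem exists_unit_of_starAct (c : TwoCocycle S D) (ε : Idem S → Dˣ) :
    ∃ r : (TwistedRing c)ˣ, ∀ s a,
      single c s ((starAct c ε 1).μ (lft s) a * (starAct c ε 1).η s) =
        r * single c s a * (r⁻¹ : (TwistedRing c)ˣ) := by
  have hmul : ∀ δ δ' : Idem S → Dˣ, (∑ e, emb c e (δ e)) * (∑ e, emb c e (δ' e)) =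
      ∑ e, emb c e (δ e * δ' e) := fun δ δ' => by
    rw [Finset.sum_mul]
    refine Finset.sum_congr rfl fun e _ => ?_
    rw [Finset.mul_sum, Finset.sum_eq_single e]
    · exact emb_mul_emb e _ _
    · exact fun f _ hf => emb_mul_emb_of_ne hf.symm _ _
    · simp
  let r : (TwistedRing c)ˣ :=
    ⟨∑ e, emb c e (ε e), ∑ e, emb c e ((ε e)⁻¹ : Dˣ),
      by rw [hmul ε fun e => (ε e)⁻¹, ← sum_emb_one]; simp,
      by rw [hmul (fun e => (ε e)⁻¹) ε, ← sum_emb_one]; simp⟩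
  have hr : (r : TwistedRing c) = ∑ e, emb c e (ε e) := rfl
  refine ⟨r, fun s a => ?_⟩
  rw [Units.eq_mul_inv_iff_mul_eq, hr, Finset.mul_sum, Finset.sum_mul,
    Finset.sum_eq_single (rgt s), Finset.sum_eq_single (lft s)]
  · rw [emb_mul_single, single_mul_emb]
    simp [starAct, rho_apply, mul_assoc]
  · exact fun f _ hf => emb_mul_single_of_ne hf.symm _ _
  · simp
  · exact fun f _ hf => single_mul_emb_of_ne hf.symm _ _
  · simp

/-! ### The criterion and its transport to `R` -/

theorem inner_iff (hS : NoLoops S) (c : TwoCocycle S D) :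
    (∀ γ : TwistedRing c ≃+* TwistedRing c, ∃ r : (TwistedRing c)ˣ, ∀ x,
      γ x = r * x * (r⁻¹ : (TwistedRing c)ˣ)) ↔ Subsingleton (H1 c) ∧ stab c = ⊥ := by
  rw [QuotientGroup.subsingleton_iff]
  constructor
  · intro hinn
    -- Each such pair defines a monomial automorphism, which is inner by assumption. Taking `φ = 1`
    -- treats `H¹`, and an arbitrary `φ` treats the stabilizer.
    have key : ∀ (φ : MulAut S) (p : OneCochain S D), Carries p (c.precomp φ) c →
        φ = 1 ∧ ∃ ε : Idem S → Dˣ, starAct c ε 1 = p := fun φ p hp => by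
      obtain ⟨r, hr⟩ := hinn (monomialEquiv φ p hp)
      refine eq_starAct_of_inner hS (r := r) fun s a => ?_
      rw [← monomialEquiv_single hp, hr, Units.inv_mul_cancel_right]
    refine ⟨?_, ?_⟩
    · rw [eq_top_iff]
      rintro ⟨p, hp⟩ -
      exact (key 1 p hp).2
    · rw [eq_bot_iff]
      intro φ hφ
      obtain ⟨p, hp⟩ := cohomologous_equivalence.symm (cls_eq_iff.1 hφ)
      exact (key φ p hp).1
  · rintro ⟨hB, hst⟩ γ
    obtain ⟨u, φ, p, hp, hu⟩ := exists_conj_monomial hS γ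
    obtain rfl : φ = (1 : MulAut S) := by
      have : φ ∈ stab c := cls_eq_iff.2 (cohomologous_equivalence.symm ⟨p, hp⟩)
      rwa [hst] at this
    obtain ⟨ε, rfl⟩ : (⟨p, hp⟩ : Z1 c) ∈ B1 c := by rw [hB]; trivial
    obtain ⟨r, hr⟩ := exists_unit_of_starAct c ε
    -- Conjugating by `u` turned `γ` into conjugation by `r`, so `γ` itself is conjugation by `u⁻¹ *
    -- r`.
    refine ⟨u⁻¹ * r, fun x => ?_⟩
    induction x using induction with
    | h0 => simp
    | hadd x y hx hy => rw [map_add, hx, hy, mul_add, add_mul]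
    | hs s a =>
      have := hu s a
      rw [Nz.map_one, hr, Units.mul_inv_eq_iff_eq_mul] at this
      rw [← Units.inv_mul_cancel_left u (γ _), this]
      simp [mul_assoc]

end TwistedRing

end SquareFree

theorem inner_of_ringEquiv {R T : Type*} [Ring R] [Ring T] (g : R ≃+* T)
    (h : ∀ γ : T ≃+* T, ∃ r : Tˣ, ∀ x, γ x = r * x * (r⁻¹ : Tˣ)) (γ : R ≃+* R) :
    ∃ r : Rˣ, ∀ x, γ x = r * x * (r⁻¹ : Rˣ) := by
  obtain ⟨r, hr⟩ := h ((g.symm.trans γ).trans g)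
  refine ⟨Units.map (g.symm : T →* R) r, fun x => g.injective ?_⟩
  have := hr (g x)
  simp only [RingEquiv.trans_apply, RingEquiv.symm_apply_apply] at this
  rw [this, ← map_inv]
  simp

theorem mainTheorem4 {R S D : Type*} [Ring R] [SquareFreeSemigroup S] [DivisionRing D]
    (hR : IsSquareFreeRing R) (c : SquareFree.TwoCocycle S D)
    (hiso : Nonempty (R ≃+* SquareFree.TwistedRing c)) :
    (∀ γ : R ≃+* R, ∃ r : Rˣ, ∀ x : R, γ x = r * x * (r⁻¹ : Rˣ)) ↔
      Subsingleton (SquareFree.H1 c) ∧ SquareFree.stab c = ⊥ := by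
  obtain ⟨g⟩ := hiso
  rw [← SquareFree.TwistedRing.inner_iff (SquareFree.TwistedRing.noLoops hR.basic g) c]
  exact ⟨inner_of_ringEquiv g.symm, inner_of_ringEquiv g⟩
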